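/- Let $V$ be a connected smooth 3-manifold and let $g$ be a $C^3$ Lorentz metric of signature $(-,+,+,+)$ on $M=V\times\mathbb R$ such that the curves $\{p\}\times\mathbb R$ are timelike and the slices $V_t=V\times\{t\}$ are spacelike. Let $\eta$ be a $C^3$ unit normal field of the slices, $g^{ab}\eta_a\eta_b=-1$. Let $\nabla$ and $R_{ab}$ be the Levi-Civita connection and the Ricci tensor of $g$ (with the sign for which round spheres have positive Ricci curvature), and put $$Y_{abc}=\nabla_aR_{bc}-\nabla_bR_{ac}.$$ Yang's equations are $Y_{abc}=0$ on $M$. On the initial slice $V_0$ let ${}^3\!g$, $K_{ab}$ and $N_{ab}$ be the pullbacks of $g_{ab}$, $\nabla_a\eta_b$ and $R_{ab}$. Let $D$ and ${}^3\!R$ be the Levi-Civita connection and the scalar curvature of ${}^3\!g$; indices on $V_0$ are raised with ${}^3\!g$, $K={}^3\!g^{ab}K_{ab}$, and $T_{[ab]}=\frac12(T_{ab}-T_{ba})$. If $g$ satisfies Yang's equations, then on $V_0$ $$D_{[c}N_{b]a}=K_{a[c}D^dK_{b]d}-K_{a[c}D_{b]}K,\tag{1}$$ $$K^d{}_{[a}N_{b]d}=D_{[a}D^dK_{b]d},\tag{2}$$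 $${}^3\!R+K^2-K_{ab}K^{ab}-2N^a{}_a=\text{constant}.\tag{3}$$ More precisely, for every such $g$, whether or not it satisfies Yang's equations: at each point of $V_0$, (1) holds if and only if the pullback to $V_0$ of $Y_{abc}$ vanishes there, and (2) holds if and only if the pullback to $V_0$ of $\eta^cY_{abc}$ vanishes there; and (3) holds on $V_0$ if and only if the pullback to $V_0$ of the contraction $g^{bc}Y_{abc}$ vanishes on all of $V_0$. -/

import Mathlib

open scoped Manifold ContDiff
open Set

noncomputable section

/-! ### Tensor calculus in a coordinate domain

`E` is the coordinate space, `b i` the `i`-th coordinate vector. A tensor field is given by its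
components, which are real functions on `E`. All derivatives below are derivatives at a point, so
that only the values near that point matter. -/

namespace Coord

variable {ι E : Type*} [Fintype ι] [DecidableEq ι] [NormedAddCommGroup E] [NormedSpace ℝ E]

/-- The partial derivative `∂ᵢ f`. -/
def pd (b : ι → E) (i : ι) (f : E → ℝ) (x : E) : ℝ := fderiv ℝ f x (b i)

/-- The components `gⁱʲ` of the inverse metric. -/
def inv (g : ι → ι → E → ℝ) (i j : ι) (x : E) : ℝ :=
  (Matrix.of fun k l => g k l x)⁻¹ i j

/-- The Christoffel symbols `Γᵏᵢⱼ` of the Levi-Civita connection. -/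
def christoffel (b : ι → E) (g : ι → ι → E → ℝ) (k i j : ι) (x : E) : ℝ :=
  (1 / 2) * ∑ l, inv g k l x *
    (pd b i (g l j) x + pd b j (g l i) x - pd b l (g i j) x)

/-- `∇_c w_a` for a covector field `w`. -/
def cov1 (b : ι → E) (g : ι → ι → E → ℝ) (w : ι → E → ℝ) (c a : ι) (x : E) : ℝ :=
  pd b c (w a) x - ∑ k, christoffel b g k c a x * w k x

/-- `∇_c T_{ad}` for a covariant 2-tensor field `T`. -/
def cov2 (b : ι → E) (g : ι → ι → E → ℝ) (T : ι → ι → E → ℝ) (c a d : ι) (x : E) : ℝ :=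
  pd b c (T a d) x - ∑ k, christoffel b g k c a x * T k d x
    - ∑ k, christoffel b g k c d x * T a k x

/-- The Ricci tensor
`R_{ij} = ∂ₖΓᵏᵢⱼ - ∂ⱼΓᵏᵢₖ + ΓᵏₖₗΓˡᵢⱼ - ΓᵏⱼₗΓˡᵢₖ` (positive on round spheres). -/
def ricci (b : ι → E) (g : ι → ι → E → ℝ) (i j : ι) (x : E) : ℝ :=
  ∑ k, pd b k (christoffel b g k i j) x - ∑ k, pd b j (christoffel b g k i k) x
    + ∑ k, ∑ l, christoffel b g k k l x * christoffel b g l i j x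
    - ∑ k, ∑ l, christoffel b g k j l x * christoffel b g l i k x

/-- The trace `T^a_a = g^{ab} T_{ab}`. -/
def trace (g : ι → ι → E → ℝ) (T : ι → ι → E → ℝ) (x : E) : ℝ :=
  ∑ i, ∑ j, inv g i j x * T i j x

/-- The scalar curvature. -/
def scalar (b : ι → E) (g : ι → ι → E → ℝ) (x : E) : ℝ :=
  trace g (ricci b g) x

/-- The mixed components `T^d_a = g^{de} T_{ea}`. -/
def mixed (g : ι → ι → E → ℝ) (T : ι → ι → E → ℝ) (d a : ι) (x : E) : ℝ :=
  ∑ e, inv g d e x * T e a x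

/-- The squared norm `T_{ab} T^{ab}`. -/
def normSq (g : ι → ι → E → ℝ) (T : ι → ι → E → ℝ) (x : E) : ℝ :=
  ∑ i, ∑ j, ∑ k, ∑ l, inv g i k x * inv g j l x * T i j x * T k l x

/-- The divergence `D^d T_{bd} = g^{de} D_e T_{bd}`. -/
def div2 (b : ι → E) (g : ι → ι → E → ℝ) (T : ι → ι → E → ℝ) (a : ι) (x : E) : ℝ :=
  ∑ d, ∑ e, inv g d e x * cov2 b g T e a d x

/-- The components `∇_a R_{bc} - ∇_b R_{ac}` of the left-hand side of Yang's equations. -/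
def yang (b : ι → E) (g : ι → ι → E → ℝ) (i j k : ι) (x : E) : ℝ :=
  cov2 b g (ricci b g) i j k x - cov2 b g (ricci b g) j i k x

end Coord

/-! ### The spacetime `V × ℝ` -/

namespace Slice

/-- The coordinate space of the 3-manifold `V`. -/
abbrev E3 : Type := EuclideanSpace ℝ (Fin 3)

/-- The coordinate space of the spacetime `V × ℝ`. -/
abbrev E4 : Type := E3 × ℝ

/-- The product model on the spacetime `V × ℝ`. -/
abbrev I4 : ModelWithCorners ℝ E4 (ModelProd E3 ℝ) := (𝓡 3).prod 𝓘(ℝ, ℝ)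

/-- Spacetime indices: `Sum.inl i` is the `i`-th index on `V`, `Sum.inr ()` the time index. -/
abbrev Idx : Type := Fin 3 ⊕ Unit

/-- Coordinate vectors on `V`. -/
def b3 (i : Fin 3) : E3 := EuclideanSpace.single i 1

/-- Coordinate vectors on `V × ℝ`. -/
def b4 : Idx → E4 := Sum.elim (fun i => (b3 i, 0)) (fun _ => (0, 1))

variable {V : Type*} [TopologicalSpace V] [ChartedSpace E3 V]

/-- A field of bilinear forms on the tangent spaces of `V × ℝ`. -/
abbrev BilinField (V : Type*) [TopologicalSpace V] [ChartedSpace E3 V] : Type _ :=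
  ∀ x : V × ℝ, TangentSpace I4 x →L[ℝ] TangentSpace I4 x →L[ℝ] ℝ

/-- A vector field on `V × ℝ`. -/
abbrev VecField (V : Type*) [TopologicalSpace V] [ChartedSpace E3 V] : Type _ :=
  ∀ x : V × ℝ, TangentSpace I4 x

/-- The inverse `(y, t) ↦ (e⁻¹ y, t)` of the product chart `e × id` of `V × ℝ`. It is meaningful
for `y ∈ e.target`. -/
def param (e : OpenPartialHomeomorph V E3) (z : E4) : V × ℝ := (e.symm z.1, z.2)

/-- The coordinate vector field `∂_a` of the chart `e × id`. -/
def coordVec (e : OpenPartialHomeomorph V E3) (a : Idx) (z : E4) :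
    TangentSpace I4 (param e z) :=
  mfderiv 𝓘(ℝ, E4) I4 (param e) z (b4 a)

/-- The components `g_{ab}` in the chart `e × id`. -/
def comp (g : BilinField V) (e : OpenPartialHomeomorph V E3) (a b : Idx) (z : E4) : ℝ :=
  g (param e z) (coordVec e a z) (coordVec e b z)

/-- The components `η_a = g_{ab} n^b` of the covector field metrically equivalent to `n`. -/
def coVecComp (g : BilinField V) (n : VecField V) (e : OpenPartialHomeomorph V E3)
    (a : Idx) (z : E4) : ℝ :=
  g (param e z) (n (param e z)) (coordVec e a z)

/-- The differential at `p` of the inclusion `q ↦ (q, t)` of the slice `V_t`. -/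
def sliceIncl (p : V) (t : ℝ) : TangentSpace (𝓡 3) p →L[ℝ] TangentSpace I4 (p, t) :=
  mfderiv (𝓡 3) I4 (fun q : V => (q, t)) p

/-- The velocity at time `t` of the curve `s ↦ (p, s)`. -/
def timeVec (p : V) (t : ℝ) : TangentSpace I4 (p, t) :=
  mfderiv 𝓘(ℝ, ℝ) I4 (fun s : ℝ => (p, s)) t (1 : ℝ)

/-- `g` is a Lorentz metric, of signature `(-,+,+,+)` and class `C³`, on `V × ℝ`. -/
structure IsLorentzMetric (g : BilinField V) : Prop where
  symm : ∀ x u v, g x u v = g x v u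
  signature : ∀ x, ∃ v : Fin 4 → TangentSpace I4 x, ∀ i j,
    g x (v i) (v j) = if i = j then (if i = 0 then -1 else 1) else 0
  regular : ∀ e ∈ atlas E3 V, ∀ a b, ContDiffOn ℝ 3 (comp g e a b) (e.target ×ˢ univ)

/-- The curves `{p} × ℝ` are timelike and the slices `V_t` are spacelike. -/
structure IsSliced (g : BilinField V) : Prop where
  timelike : ∀ p t, g (p, t) (timeVec p t) (timeVec p t) < 0
  spacelike : ∀ p t (v : TangentSpace (𝓡 3) p), v ≠ 0 →
    0 < g (p, t) (sliceIncl p t v) (sliceIncl p t v)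

/-- `n` is a unit normal field, of class `C³`, of the slices `V_t`. -/
structure IsUnitNormal (g : BilinField V) (n : VecField V) : Prop where
  normal : ∀ p t (v : TangentSpace (𝓡 3) p), g (p, t) (n (p, t)) (sliceIncl p t v) = 0
  unit : ∀ x, g x (n x) (n x) = -1
  regular : ∀ e ∈ atlas E3 V, ∀ a, ContDiffOn ℝ 3 (coVecComp g n e a) (e.target ×ˢ univ)

/-- Yang's equations `∇_a R_{bc} - ∇_b R_{ac} = 0` on `V × ℝ`. -/
def YangEq (g : BilinField V) : Prop :=
  ∀ e ∈ atlas E3 V, ∀ y ∈ e.target, ∀ t : ℝ, ∀ a b c, Coord.yang b4 (comp g e) a b c (y, t) = 0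

/-! ### Initial data on `V₀ = V × {0}`

In the coordinates `e × id` the inclusion of `V₀` is `y ↦ (y, 0)`, so a covariant tensor is pulled
back by restricting its indices to those of `V` and its argument to `(y, 0)`. -/

/-- The pullback to `V₀` of a covariant 2-tensor. -/
def pull (T : Idx → Idx → E4 → ℝ) (i j : Fin 3) (y : E3) : ℝ := T (.inl i) (.inl j) (y, 0)

/-- The induced metric `³g_{ij}`. -/
def metric3 (g : BilinField V) (e : OpenPartialHomeomorph V E3) : Fin 3 → Fin 3 → E3 → ℝ :=
  pull (comp g e)

/-- The second fundamental form `K`, the pullback of `∇_a η_b`. -/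
def secondForm (g : BilinField V) (n : VecField V) (e : OpenPartialHomeomorph V E3) :
    Fin 3 → Fin 3 → E3 → ℝ :=
  pull (Coord.cov1 b4 (comp g e) (coVecComp g n e))

/-- The pullback `N` of the Ricci tensor of `g`. -/
def ricciPull (g : BilinField V) (e : OpenPartialHomeomorph V E3) : Fin 3 → Fin 3 → E3 → ℝ :=
  pull (Coord.ricci b4 (comp g e))

/-- The mean curvature `K = ³g^{ij} K_{ij}`. -/
def meanCurv (g : BilinField V) (n : VecField V) (e : OpenPartialHomeomorph V E3) : E3 → ℝ :=
  Coord.trace (metric3 g e) (secondForm g n e)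

/-- `D_{[c}N_{b]a} = K_{a[c}D^dK_{b]d} - K_{a[c}D_{b]}K` at the point `y` of the chart `e`. -/
def Constraint1 (g : BilinField V) (n : VecField V) (e : OpenPartialHomeomorph V E3)
    (y : E3) : Prop :=
  let h := metric3 g e
  let K := secondForm g n e
  let N := ricciPull g e
  ∀ a b c : Fin 3,
    (1 / 2) * (Coord.cov2 b3 h N c b a y - Coord.cov2 b3 h N b c a y) =
      (1 / 2) * (K a c y * Coord.div2 b3 h K b y - K a b y * Coord.div2 b3 h K c y)
      - (1 / 2) * (K a c y * Coord.pd b3 b (meanCurv g n e) y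
          - K a b y * Coord.pd b3 c (meanCurv g n e) y)

/-- `K^d_{[a}N_{b]d} = D_{[a}D^dK_{b]d}` at the point `y` of the chart `e`. -/
def Constraint2 (g : BilinField V) (n : VecField V) (e : OpenPartialHomeomorph V E3)
    (y : E3) : Prop :=
  let h := metric3 g e
  let K := secondForm g n e
  let N := ricciPull g e
  ∀ a b : Fin 3,
    (1 / 2) * (∑ d, Coord.mixed h K d a y * N b d y - ∑ d, Coord.mixed h K d b y * N a d y) =
      (1 / 2) * (Coord.cov1 b3 h (Coord.div2 b3 h K) a b y
        - Coord.cov1 b3 h (Coord.div2 b3 h K) b a y)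

/-- `³R + K² - K_{ab}K^{ab} - 2N^a_a` is constant on `V₀`. -/
def Constraint3 (g : BilinField V) (n : VecField V) : Prop :=
  ∃ C : ℝ, ∀ e ∈ atlas E3 V, ∀ y ∈ e.target,
    Coord.scalar b3 (metric3 g e) y + meanCurv g n e y ^ 2
      - Coord.normSq (metric3 g e) (secondForm g n e) y
      - 2 * Coord.trace (metric3 g e) (ricciPull g e) y = C

/-- The pullback to `V₀` of `∇_a R_{bc} - ∇_b R_{ac}` vanishes at `y`. -/
def YangTangential (g : BilinField V) (e : OpenPartialHomeomorph V E3) (y : E3) : Prop :=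
  ∀ i j k : Fin 3, Coord.yang b4 (comp g e) (.inl i) (.inl j) (.inl k) (y, 0) = 0

/-- The pullback to `V₀` of `η^c (∇_a R_{bc} - ∇_b R_{ac})` vanishes at `y`. -/
def YangNormal (g : BilinField V) (n : VecField V) (e : OpenPartialHomeomorph V E3)
    (y : E3) : Prop :=
  ∀ i j : Fin 3, ∑ c, ∑ d, Coord.inv (comp g e) c d (y, 0) * coVecComp g n e d (y, 0) *
    Coord.yang b4 (comp g e) (.inl i) (.inl j) c (y, 0) = 0

/-- The pullback to `V₀` of `g^{bc} (∇_a R_{bc} - ∇_b R_{ac})` vanishes at `y`. -/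
def YangTrace (g : BilinField V) (e : OpenPartialHomeomorph V E3) (y : E3) : Prop :=
  ∀ i : Fin 3, ∑ c, ∑ d, Coord.inv (comp g e) c d (y, 0) *
    Coord.yang b4 (comp g e) (.inl i) c d (y, 0) = 0

end Slice

end

/-! All three equivalences are projections of `Y` onto the slice, computed in one chart `e × id`.
Write `J_j = R_{jm} n^m` for the mixed component of the Ricci tensor along `V₀` (`momentum`), `R`
for the scalar curvature of spacetime and `Ric(n,n) = R_{ab} n^a n^b`. Two contracted classical
equations eliminate the components that are not initial data: Codazzi gives `D^d K_{jd} - D_j K =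
J_j` (`codazzi_contracted`), and Gauss gives `³R + K² - K_{ab}K^{ab} = R + 2 Ric(n,n)`
(`gauss_contracted`).

For (1), the slice connection differs from that of spacetime by the normal term `n K`, so `D_i
N_{jk} = ∇_i R_{jk} + K_{ij} J_k + K_{ik} J_j` on tangential indices. Antisymmetrizing in `i, j`
removes the term with `K_{ij}`; inserting Codazzi for `J` leaves exactly the difference of the two
sides of (1), up to a factor.

For (2), the product rule for `R(∂_j, n)` and the Weingarten equation `∇_i n = K_i^d ∂_d` give
`Y_{ijc} n^c = ∂_i J_j - ∂_j J_i - (K^d_i N_{jd} - K^d_j N_{id})`. By Codazzi `J` is the divergence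
of `K_{ab}` minus the gradient of the mean curvature, and the curl of a gradient vanishes.

For (3), `N^a_a = R + Ric(n,n)`, so the left-hand side of (3) is `-R` (`scalar_constraint`). The
contracted Bianchi identity gives `g^{bc} Y_{abc} = ∂_a R - ½ ∂_a R = ½ ∂_a R` (`trace_yang`). Hence
the trace vanishes tangentially on `V₀` if and only if `R` is locally constant there, which on the
connected manifold `V` means constant; this last step needs `R` to be independent of the chart
(`scalar_comp`).

Connections are handled as matrices `Γ_i` with curvature `∂_iΓ_j - ∂_jΓ_i + [Γ_i, Γ_j]`, so that
most tensor identities become noncommutative matrix algebra. The regularity is just sufficient: `g`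
is `C³`, `Γ` is `C²`, and the curvature is `C¹`. -/

noncomputable section

/-! ### Partial derivatives of functions and of matrix-valued functions. -/

namespace Coord

section Calculus

variable {E : Type*} [NormedAddCommGroup E] [NormedSpace ℝ E]
variable {κ ι₁ ι₂ ι₃ : Type*} {b : κ → E} {U : Set E} {x : E}

theorem pd_add {f g : E → ℝ} (hf : DifferentiableAt ℝ f x) (hg : DifferentiableAt ℝ g x) (i : κ) :
    pd b i (fun y => f y + g y) x = pd b i f x + pd b i g x := by
  simp [pd, fderiv_fun_add hf hg]

theorem pd_sub {f g : E → ℝ} (hf : DifferentiableAt ℝ f x) (hg : DifferentiableAt ℝ g x) (i : κ) :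
    pd b i (fun y => f y - g y) x = pd b i f x - pd b i g x := by
  simp [pd, fderiv_fun_sub hf hg]

theorem pd_mul {f g : E → ℝ} (hf : DifferentiableAt ℝ f x) (hg : DifferentiableAt ℝ g x) (i : κ) :
    pd b i (fun y => f y * g y) x = pd b i f x * g x + f x * pd b i g x := by
  simp [pd, fderiv_fun_mul hf hg]; ring

theorem pd_sum {s : Finset ι₁} {f : ι₁ → E → ℝ} (hf : ∀ k ∈ s, DifferentiableAt ℝ (f k) x)
    (i : κ) : pd b i (fun y => ∑ k ∈ s, f k y) x = ∑ k ∈ s, pd b i (f k) x := by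
  simp [pd, fderiv_fun_sum hf]

theorem pd_const (c : ℝ) (i : κ) : pd b i (fun _ => c) x = 0 := by
  simp [pd]

theorem pd_congr {f g : E → ℝ} (hU : IsOpen U) (hx : x ∈ U) (h : ∀ y ∈ U, f y = g y) (i : κ) :
    pd b i f x = pd b i g x := by
  have : f =ᶠ[nhds x] g := Filter.eventuallyEq_of_mem (hU.mem_nhds hx) h
  rw [pd, pd, this.fderiv_eq]

theorem contDiffOn_pd {f : E → ℝ} {m n : WithTop ℕ∞} (hf : ContDiffOn ℝ n f U) (hU : IsOpen U)
    (hmn : m + 1 ≤ n) (i : κ) : ContDiffOn ℝ m (pd b i f) U :=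
  (hf.fderiv_of_isOpen hU hmn).clm_apply contDiffOn_const

theorem pd_comm {f : E → ℝ} (hf : ContDiffOn ℝ 2 f U) (hU : IsOpen U) (hx : x ∈ U) (i j : κ) :
    pd b i (pd b j f) x = pd b j (pd b i f) x := by
  have h2 : ContDiffAt ℝ 2 f x := hf.contDiffAt (hU.mem_nhds hx)
  have hd : DifferentiableAt ℝ (fderiv ℝ f) x :=
    (h2.fderiv_right (m := 1) (by norm_num)).differentiableAt (by norm_num)
  have hs : IsSymmSndFDerivAt ℝ f x := h2.isSymmSndFDerivAt (by simp)
  have key : ∀ i j : κ, pd b i (pd b j f) x = fderiv ℝ (fderiv ℝ f) x (b i) (b j) := by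
    intro i j
    unfold pd
    rw [fderiv_clm_apply hd (differentiableAt_const _)]
    simp
  rw [key, key, hs]

/-- The entrywise partial derivative of a matrix-valued function. -/
def mpd (b : κ → E) (i : κ) (M : E → Matrix ι₁ ι₂ ℝ) (x : E) : Matrix ι₁ ι₂ ℝ :=
  Matrix.of fun k l => pd b i (fun y => M y k l) x

/-- A matrix-valued function with entries of class `Cⁿ`. -/
def CM (n : WithTop ℕ∞) (M : E → Matrix ι₁ ι₂ ℝ) (U : Set E) : Prop :=
  ∀ k l, ContDiffOn ℝ n (fun y => M y k l) U

theorem CM.differentiableAt {M : E → Matrix ι₁ ι₂ ℝ} {n : WithTop ℕ∞} (hM : CM n M U)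
    (hU : IsOpen U) (hx : x ∈ U) (hn : n ≠ 0 := by norm_num) (k : ι₁) (l : ι₂) :
    DifferentiableAt ℝ (fun y => M y k l) x :=
  ((hM k l).contDiffAt (hU.mem_nhds hx)).differentiableAt hn

theorem CM.of_le {M : E → Matrix ι₁ ι₂ ℝ} {m n : WithTop ℕ∞} (hM : CM n M U) (h : m ≤ n) :
    CM m M U := fun k l => (hM k l).of_le h

theorem CM.congr {M N : E → Matrix ι₁ ι₂ ℝ} {n : WithTop ℕ∞} (hM : CM n M U)
    (h : ∀ y ∈ U, N y = M y) : CM n N U :=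
  fun k l => (hM k l).congr fun y hy => by rw [h y hy]

theorem CM.add {M N : E → Matrix ι₁ ι₂ ℝ} {n : WithTop ℕ∞} (hM : CM n M U) (hN : CM n N U) :
    CM n (fun y => M y + N y) U := fun k l => (hM k l).add (hN k l)

theorem CM.sub {M N : E → Matrix ι₁ ι₂ ℝ} {n : WithTop ℕ∞} (hM : CM n M U) (hN : CM n N U) :
    CM n (fun y => M y - N y) U := fun k l => (hM k l).sub (hN k l)

theorem CM.transpose {M : E → Matrix ι₁ ι₂ ℝ} {n : WithTop ℕ∞} (hM : CM n M U) :
    CM n (fun y => (M y).transpose) U := fun k l => hM l k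

theorem CM.mul [Fintype ι₂] {M : E → Matrix ι₁ ι₂ ℝ} {N : E → Matrix ι₂ ι₃ ℝ} {n : WithTop ℕ∞}
    (hM : CM n M U) (hN : CM n N U) : CM n (fun y => M y * N y) U := fun k l => by
  simp only [Matrix.mul_apply]
  exact ContDiffOn.sum fun m _ => (hM k m).mul (hN m l)

theorem CM.smul {f : E → ℝ} {M : E → Matrix ι₁ ι₂ ℝ} {n : WithTop ℕ∞}
    (hf : ContDiffOn ℝ n f U) (hM : CM n M U) : CM n (fun y => f y • M y) U :=
  fun k l => hf.mul (hM k l)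

theorem CM.sum {s : Finset ι₃} {M : ι₃ → E → Matrix ι₁ ι₂ ℝ} {n : WithTop ℕ∞}
    (hM : ∀ m, CM n (M m) U) : CM n (fun y => ∑ m ∈ s, M m y) U := fun k l => by
  simp only [Matrix.sum_apply]
  exact ContDiffOn.sum fun m _ => hM m k l

theorem CM.mpd {M : E → Matrix ι₁ ι₂ ℝ} {m n : WithTop ℕ∞} (hM : CM n M U) (hU : IsOpen U)
    (hmn : m + 1 ≤ n) (i : κ) : CM m (mpd b i M) U :=
  fun k l => contDiffOn_pd (hM k l) hU hmn i

theorem CM.det [Fintype ι₁] [DecidableEq ι₁] {M : E → Matrix ι₁ ι₁ ℝ} {n : WithTop ℕ∞}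
    (hM : CM n M U) : ContDiffOn ℝ n (fun y => (M y).det) U := by
  simp only [Matrix.det_apply']
  exact ContDiffOn.sum fun σ _ => contDiffOn_const.mul (contDiffOn_prod fun i _ => hM (σ i) i)

/-- Cramer's rule: every entry of the inverse is a quotient of two determinants, which are
polynomials in the entries. -/
theorem CM.inv [Fintype ι₁] [DecidableEq ι₁] {M : E → Matrix ι₁ ι₁ ℝ} {n : WithTop ℕ∞}
    (hM : CM n M U) (hdet : ∀ y ∈ U, (M y).det ≠ 0) : CM n (fun y => (M y)⁻¹) U := by
  intro k l
  have : ∀ y, (M y)⁻¹ k l = ((M y).det)⁻¹ * ((M y).updateRow l (Pi.single k 1)).det := by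
    intro y
    rw [Matrix.inv_def, Ring.inverse_eq_inv', Matrix.smul_apply, Matrix.adjugate_apply,
      smul_eq_mul]
  simp only [this]
  refine (hM.det.inv hdet).mul (CM.det fun i j => ?_)
  by_cases h : i = l
  · subst h
    simpa using contDiffOn_const
  · simpa [Matrix.updateRow_apply, h] using hM i j

theorem mpd_add {M N : E → Matrix ι₁ ι₂ ℝ} {n m : WithTop ℕ∞} (hM : CM n M U) (hN : CM m N U)
    (hU : IsOpen U) (hx : x ∈ U) (hn : n ≠ 0 := by norm_num) (hm : m ≠ 0 := by norm_num) (i : κ) :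
    mpd b i (fun y => M y + N y) x = mpd b i M x + mpd b i N x := by
  ext k l
  exact pd_add (hM.differentiableAt hU hx hn k l) (hN.differentiableAt hU hx hm k l) i

theorem mpd_sub {M N : E → Matrix ι₁ ι₂ ℝ} {n m : WithTop ℕ∞} (hM : CM n M U) (hN : CM m N U)
    (hU : IsOpen U) (hx : x ∈ U) (hn : n ≠ 0 := by norm_num) (hm : m ≠ 0 := by norm_num) (i : κ) :
    mpd b i (fun y => M y - N y) x = mpd b i M x - mpd b i N x := by
  ext k l
  exact pd_sub (hM.differentiableAt hU hx hn k l) (hN.differentiableAt hU hx hm k l) i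

theorem mpd_mul [Fintype ι₂] {M : E → Matrix ι₁ ι₂ ℝ} {N : E → Matrix ι₂ ι₃ ℝ}
    {n m : WithTop ℕ∞} (hM : CM n M U) (hN : CM m N U)
    (hU : IsOpen U) (hx : x ∈ U) (hn : n ≠ 0 := by norm_num) (hm : m ≠ 0 := by norm_num) (i : κ) :
    mpd b i (fun y => M y * N y) x = mpd b i M x * N x + M x * mpd b i N x := by
  ext k l
  have h1 := hM.differentiableAt hU hx hn
  have h2 := hN.differentiableAt hU hx hm
  simp only [mpd, Matrix.of_apply, Matrix.add_apply, Matrix.mul_apply]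
  rw [pd_sum (f := fun p y => M y k p * N y p l) (fun p _ => (h1 k p).mul (h2 p l)),
    ← Finset.sum_add_distrib]
  exact Finset.sum_congr rfl fun p _ => pd_mul (h1 k p) (h2 p l) i

theorem mpd_transpose (M : E → Matrix ι₁ ι₂ ℝ) (i : κ) :
    mpd b i (fun y => (M y).transpose) x = (mpd b i M x).transpose := rfl

theorem mpd_congr {M N : E → Matrix ι₁ ι₂ ℝ} (hU : IsOpen U) (hx : x ∈ U)
    (h : ∀ y ∈ U, M y = N y) (i : κ) : mpd b i M x = mpd b i N x := by
  ext k l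
  exact pd_congr hU hx (fun y hy => by rw [h y hy]) i

theorem mpd_comm {M : E → Matrix ι₁ ι₂ ℝ} (hM : CM 2 M U) (hU : IsOpen U) (hx : x ∈ U)
    (i j : κ) : mpd b i (mpd b j M) x = mpd b j (mpd b i M) x := by
  ext k l
  exact pd_comm (hM k l) hU hx i j

end Calculus

end Coord

/-! ### Levi-Civita connection matrices, curvature and its symmetries. -/

namespace Coord

section Metric

variable {ι κ ι₁ ι₂ E : Type*} [NormedAddCommGroup E] [NormedSpace ℝ E]

/-- The matrix of the components of a covariant 2-tensor field. -/
def toMat (T : ι₁ → ι₂ → E → ℝ) (x : E) : Matrix ι₁ ι₂ ℝ := Matrix.of fun i j => T i j x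

/-- The curvature `∂ᵢΓⱼ - ∂ⱼΓᵢ + [Γᵢ, Γⱼ]` of the connection matrices `Γᵢ`. -/
def curv [Fintype ι] (b : κ → E) (Γ : κ → E → Matrix ι ι ℝ) (i j : κ) (x : E) : Matrix ι ι ℝ :=
  mpd b i (Γ j) x - mpd b j (Γ i) x + Γ i x * Γ j x - Γ j x * Γ i x

theorem curv_swap [Fintype ι] (b : κ → E) (Γ : κ → E → Matrix ι ι ℝ) (i j : κ) (x : E) :
    curv b Γ i j x = -curv b Γ j i x := by
  unfold curv; abel

theorem CM.curv [Fintype ι] {b : κ → E} {Γ : κ → E → Matrix ι ι ℝ} {U : Set E}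
    (hΓ : ∀ i, CM 2 (Γ i) U) (hU : IsOpen U) (i j : κ) : CM 1 (curv b Γ i j) U := by
  have h1 : ∀ i j, CM 1 (Coord.mpd b i (Γ j)) U := fun i j =>
    (hΓ j).mpd hU (by norm_num [one_add_one_eq_two]) i
  have h2 : ∀ i, CM 1 (Γ i) U := fun i => (hΓ i).of_le (by norm_num)
  exact (((h1 i j).sub (h1 j i)).add ((h2 i).mul (h2 j))).sub ((h2 j).mul (h2 i))

/-- The second Bianchi identity. -/
theorem bianchi_second [Fintype ι] [DecidableEq ι] {b : κ → E} {Γ : κ → E → Matrix ι ι ℝ}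
    {U : Set E} (hΓ : ∀ i, CM 2 (Γ i) U) (hU : IsOpen U) {x : E} (hx : x ∈ U) (c i j : κ) :
    (mpd b c (curv b Γ i j) x + Γ c x * curv b Γ i j x - curv b Γ i j x * Γ c x) +
    (mpd b i (curv b Γ j c) x + Γ i x * curv b Γ j c x - curv b Γ j c x * Γ i x) +
    (mpd b j (curv b Γ c i) x + Γ j x * curv b Γ c i x - curv b Γ c i x * Γ j x) = 0 := by
  have h1 : ∀ i j, CM 1 (mpd b i (Γ j)) U := fun i j =>
    (hΓ j).mpd hU (by norm_num [one_add_one_eq_two]) i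
  have h2 : ∀ i, CM 1 (Γ i) U := fun i => (hΓ i).of_le (by norm_num)
  have key : ∀ c i j, mpd b c (curv b Γ i j) x =
      mpd b c (mpd b i (Γ j)) x - mpd b c (mpd b j (Γ i)) x
        + (mpd b c (Γ i) x * Γ j x + Γ i x * mpd b c (Γ j) x)
        - (mpd b c (Γ j) x * Γ i x + Γ j x * mpd b c (Γ i) x) := by
    intro c i j
    unfold curv
    rw [mpd_sub (((h1 i j).sub (h1 j i)).add ((h2 i).mul (h2 j))) ((h2 j).mul (h2 i)) hU hx,
      mpd_add ((h1 i j).sub (h1 j i)) ((h2 i).mul (h2 j)) hU hx,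
      mpd_sub (h1 i j) (h1 j i) hU hx, mpd_mul (h2 i) (h2 j) hU hx,
      mpd_mul (h2 j) (h2 i) hU hx]
  -- The second derivatives cancel in the cyclic sum because mixed partials commute; the rest is the
  -- Jacobi identity for matrix commutators.
  rw [key, key, key, mpd_comm (hΓ j) hU hx c i, mpd_comm (hΓ i) hU hx c j,
    mpd_comm (hΓ c) hU hx i j]
  unfold curv
  noncomm_ring

variable [Fintype ι] [DecidableEq ι]

/-- A pseudo-Riemannian metric of class `C³` on an open set. -/
structure IsMetricOn (g : ι → ι → E → ℝ) (U : Set E) : Prop where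
  isOpen : IsOpen U
  symm : ∀ i j, g i j = g j i
  contDiffOn : ∀ i j, ContDiffOn ℝ 3 (g i j) U
  det_ne_zero : ∀ x ∈ U, (toMat g x).det ≠ 0

/-- The matrix `Γᵏ_c_a` of the connection in the direction `c`. -/
def conn (b : ι → E) (g : ι → ι → E → ℝ) (c : ι) (x : E) : Matrix ι ι ℝ :=
  Matrix.of fun k a => christoffel b g k c a x

/-- The Christoffel symbols of the first kind. -/
def koszul (b : ι → E) (g : ι → ι → E → ℝ) (c : ι) (x : E) : Matrix ι ι ℝ :=
  Matrix.of fun l a => (1 / 2) * (pd b c (g l a) x + pd b a (g l c) x - pd b l (g c a) x)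

variable {b : ι → E} {g : ι → ι → E → ℝ} {U : Set E} {x : E}

theorem conn_eq (c : ι) : conn b g c x = (toMat g x)⁻¹ * koszul b g c x := by
  ext k a
  simp only [conn, christoffel, koszul, Matrix.of_apply, Matrix.mul_apply, Finset.mul_sum, inv,
    toMat]
  exact Finset.sum_congr rfl fun l _ => by ring

theorem cov2_eq (T : ι → ι → E → ℝ) (c a d : ι) :
    cov2 b g T c a d x = (mpd b c (toMat T) x - (conn b g c x).transpose * toMat T x
      - toMat T x * conn b g c x) a d := by
  simp only [cov2, mpd, toMat, conn, Matrix.sub_apply, Matrix.mul_apply, Matrix.transpose_apply,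
    Matrix.of_apply, mul_comm]

namespace IsMetricOn

variable (hg : IsMetricOn g U)
include hg

theorem isUnit (hx : x ∈ U) : IsUnit (toMat g x).det := (hg.det_ne_zero x hx).isUnit

theorem transpose_toMat : (toMat g x).transpose = toMat g x := by
  ext i j
  simp [toMat, hg.symm i j]

theorem transpose_inv : ((toMat g x)⁻¹).transpose = (toMat g x)⁻¹ := by
  rw [Matrix.transpose_nonsing_inv, hg.transpose_toMat]

theorem inv_symm (i j : ι) : inv g i j x = inv g j i x := by
  conv_lhs => rw [inv, ← toMat, ← hg.transpose_inv]
  rfl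

theorem christoffel_symm (k i j : ι) : christoffel b g k i j x = christoffel b g k j i x := by
  unfold christoffel
  congr 1
  refine Finset.sum_congr rfl fun l _ => ?_
  rw [hg.symm i j]
  ring

/-- The two expressions differ only in the order of the lower indices of the Christoffel symbols,
which is immaterial. -/
theorem ricci_eq (i j : ι) : ricci b g i j x = ∑ k, curv b (conn b g) k j x k i := by
  have h : ∀ k i j, christoffel b g k i j = christoffel b g k j i := fun k i j =>
    funext fun y => hg.christoffel_symm k i j
  simp only [ricci, curv, Matrix.add_apply, Matrix.sub_apply, Matrix.mul_apply,
    Finset.sum_add_distrib, Finset.sum_sub_distrib, mpd, Matrix.of_apply, conn]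
  simp only [h _ i]

theorem cm_toMat : CM 3 (toMat g) U := fun i j => hg.contDiffOn i j

theorem cm_inv : CM 3 (fun y => (toMat g y)⁻¹) U := hg.cm_toMat.inv hg.det_ne_zero

theorem cm_conn (c : ι) : CM 2 (conn b g c) U := by
  have h : ∀ i j k, ContDiffOn ℝ 2 (pd b k (g i j)) U := fun i j k =>
    contDiffOn_pd (hg.contDiffOn i j) hg.isOpen (by norm_num [two_add_one_eq_three]) k
  have hk : CM 2 (koszul b g c) U := fun l a =>
    contDiffOn_const.mul (((h l a c).add (h l c a)).sub (h c a l))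
  exact ((hg.cm_inv.of_le (by norm_num)).mul hk).congr fun y _ => conn_eq c

theorem cm_ricci : CM 1 (toMat (ricci b g)) U := fun i j => by
  simp only [toMat, Matrix.of_apply, hg.ricci_eq]
  exact ContDiffOn.sum fun k _ => CM.curv hg.cm_conn hg.isOpen k j k i

theorem mul_conn (hx : x ∈ U) (c : ι) : toMat g x * conn b g c x = koszul b g c x := by
  rw [conn_eq, Matrix.mul_nonsing_inv_cancel_left _ _ (hg.isUnit hx)]

/-- Metric compatibility `∇g = 0`: in the Koszul matrix plus its transpose, all terms other than
`∂_c g` cancel. -/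
theorem mpd_toMat (hx : x ∈ U) (c : ι) : mpd b c (toMat g) x =
    (conn b g c x).transpose * toMat g x + toMat g x * conn b g c x := by
  have : (conn b g c x).transpose * toMat g x = (toMat g x * conn b g c x).transpose := by
    rw [Matrix.transpose_mul, hg.transpose_toMat]
  rw [this, hg.mul_conn hx]
  ext i j
  simp only [mpd, toMat, koszul, Matrix.of_apply, Matrix.add_apply, Matrix.transpose_apply]
  rw [hg.symm j i, hg.symm c i, hg.symm c j]
  ring

/-- `∇g⁻¹ = 0`, obtained by differentiating `g g⁻¹ = 1` and inserting metric compatibility. -/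
theorem mpd_inv (hx : x ∈ U) (c : ι) : mpd b c (fun y => (toMat g y)⁻¹) x =
    -((toMat g x)⁻¹ * (conn b g c x).transpose) - conn b g c x * (toMat g x)⁻¹ := by
  have h0 : mpd b c (fun y => toMat g y * (toMat g y)⁻¹) x = 0 := by
    rw [mpd_congr (N := fun _ => 1) hg.isOpen hx
      (fun y hy => Matrix.mul_nonsing_inv _ (hg.isUnit hy))]
    ext i j
    exact pd_const _ c
  rw [mpd_mul hg.cm_toMat hg.cm_inv hg.isOpen hx, hg.mpd_toMat hx] at h0
  have h1 := congrArg (fun M => (toMat g x)⁻¹ * M) h0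
  simp only [mul_zero, Matrix.mul_add, Matrix.add_mul, Matrix.mul_assoc] at h1
  rw [Matrix.nonsing_inv_mul_cancel_left _ _ (hg.isUnit hx),
    Matrix.nonsing_inv_mul_cancel_left _ _ (hg.isUnit hx),
    Matrix.mul_nonsing_inv _ (hg.isUnit hx), mul_one] at h1
  rw [eq_comm, ← sub_eq_zero, ← neg_eq_zero, ← h1]
  abel

/-- Differentiating metric compatibility once more and using `∂_i∂_j g = ∂_j∂_i g` makes the
curvature skew with respect to `g`. -/
theorem toMat_mul_curv (hx : x ∈ U) (i j : ι) :
    toMat g x * curv b (conn b g) i j x =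
      -((curv b (conn b g) i j x).transpose * toMat g x) := by
  have hU := hg.isOpen
  have h2 : ∀ i, CM 2 (conn b g i) U := hg.cm_conn
  have h3 : CM 3 (toMat g) U := hg.cm_toMat
  have key : ∀ i j, mpd b i (mpd b j (toMat g)) x =
      (mpd b i (conn b g j) x).transpose * toMat g x
      + (conn b g j x).transpose * mpd b i (toMat g) x
      + (mpd b i (toMat g) x * conn b g j x + toMat g x * mpd b i (conn b g j) x) := by
    intro i j
    rw [mpd_congr hU hx (fun y hy => hg.mpd_toMat hy j),
      mpd_add ((h2 j).transpose.mul (h3.of_le (by norm_num) : CM 2 _ U))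
        ((h3.of_le (by norm_num) : CM 2 _ U).mul (h2 j)) hU hx,
      mpd_mul (h2 j).transpose h3 hU hx, mpd_mul h3 (h2 j) hU hx, mpd_transpose]
  have h := mpd_comm (b := b) (h3.of_le (by norm_num)) hU hx i j
  rw [key, key, hg.mpd_toMat hx, hg.mpd_toMat hx, ← sub_eq_zero] at h
  rw [eq_neg_iff_add_eq_zero, ← h]
  simp only [curv, Matrix.transpose_add, Matrix.transpose_sub, Matrix.transpose_mul]
  noncomm_ring

/-- The curvature with its last index raised is skew. -/
theorem transpose_curv_mul_inv (hx : x ∈ U) (i j : ι) :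
    (curv b (conn b g) i j x * (toMat g x)⁻¹).transpose =
      -(curv b (conn b g) i j x * (toMat g x)⁻¹) := by
  have h := congrArg (fun M => (toMat g x)⁻¹ * M * (toMat g x)⁻¹) (hg.toMat_mul_curv (b := b) hx i j)
  simp only [Matrix.mul_neg, Matrix.neg_mul, Matrix.mul_assoc] at h
  rw [Matrix.nonsing_inv_mul_cancel_left _ _ (hg.isUnit hx),
    Matrix.mul_nonsing_inv _ (hg.isUnit hx), mul_one] at h
  rw [Matrix.transpose_mul, hg.transpose_inv, h, neg_neg]

theorem trace_curv (hx : x ∈ U) (i j : ι) : (curv b (conn b g) i j x).trace = 0 := by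
  have h := congrArg (fun M => ((toMat g x)⁻¹ * M).trace) (hg.toMat_mul_curv (b := b) hx i j)
  simp only [Matrix.mul_neg, Matrix.trace_neg] at h
  rw [Matrix.nonsing_inv_mul_cancel_left _ _ (hg.isUnit hx), Matrix.trace_mul_comm,
    Matrix.mul_assoc, Matrix.mul_nonsing_inv _ (hg.isUnit hx), mul_one,
    Matrix.trace_transpose] at h
  linarith

/-- The first Bianchi identity. -/
theorem bianchi_first (d i j k : ι) : curv b (conn b g) i j x d k + curv b (conn b g) j k x d i
    + curv b (conn b g) k i x d j = 0 := by
  have hs : ∀ i j k, (fun y => conn b g i y k j) = fun y => conn b g j y k i := fun i j k =>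
    funext fun y => hg.christoffel_symm k i j
  have hs' : ∀ i j k, conn b g i x k j = conn b g j x k i := fun i j k =>
    hg.christoffel_symm k i j
  simp only [curv, Matrix.add_apply, Matrix.sub_apply, Matrix.mul_apply, mpd, Matrix.of_apply]
  rw [hs j k, hs i k, hs i j]
  simp only [hs' j k, hs' i k, hs' i j]
  ring

/-- Trace the first Bianchi identity: one of its three terms is the trace of a `g`-skew
endomorphism, hence zero, and the other two are Ricci components with opposite signs. -/
theorem ricci_symm (hx : x ∈ U) (i j : ι) : ricci b g i j x = ricci b g j i x := by
  have h : ∑ k, (curv b (conn b g) k j x k i + curv b (conn b g) j i x k k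
      + curv b (conn b g) i k x k j) = 0 :=
    Finset.sum_eq_zero fun k _ => hg.bianchi_first k k j i
  rw [Finset.sum_add_distrib, Finset.sum_add_distrib] at h
  have h2 : ∑ k, curv b (conn b g) j i x k k = 0 := hg.trace_curv hx j i
  have h3 : ∑ k, curv b (conn b g) i k x k j = -∑ k, curv b (conn b g) k i x k j := by
    rw [← Finset.sum_neg_distrib]
    exact Finset.sum_congr rfl fun k _ => by rw [curv_swap]; rfl
  rw [hg.ricci_eq, hg.ricci_eq]
  linarith

end IsMetricOn

end Metric

end Coord

/-! ### The contracted Bianchi identity and the trace of Yang's equations. -/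

namespace Coord

section ContractedBianchi

variable {ι E : Type*} [NormedAddCommGroup E] [NormedSpace ℝ E] [Fintype ι] [DecidableEq ι]
variable {b : ι → E} {g : ι → ι → E → ℝ} {U : Set E} {x : E}

/-- The curvature with its last index raised. -/
def curvUp (b : ι → E) (g : ι → ι → E → ℝ) (i j : ι) (x : E) : Matrix ι ι ℝ :=
  curv b (conn b g) i j x * (toMat g x)⁻¹

/-- The Ricci tensor with its second index raised. -/
def ricciUp (b : ι → E) (g : ι → ι → E → ℝ) (x : E) : Matrix ι ι ℝ :=
  toMat (ricci b g) x * (toMat g x)⁻¹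

theorem curvUp_swap (i j : ι) : curvUp b g i j x = -curvUp b g j i x := by
  rw [curvUp, curvUp, curv_swap, neg_mul]

theorem mpd_curvUp_swap (c i j k l : ι) :
    mpd b c (curvUp b g i j) x k l = -mpd b c (curvUp b g j i) x k l := by
  have : curvUp b g i j = fun y => -curvUp b g j i y := funext fun y => curvUp_swap i j
  rw [this]
  simp [mpd, pd, fderiv_fun_neg]

namespace IsMetricOn

variable (hg : IsMetricOn g U)
include hg

theorem cm_curvUp (i j : ι) : CM 1 (curvUp b g i j) U :=
  (CM.curv hg.cm_conn hg.isOpen i j).mul (hg.cm_inv.of_le (by norm_num))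

theorem cm_ricciUp : CM 1 (ricciUp b g) U :=
  hg.cm_ricci.mul (hg.cm_inv.of_le (by norm_num))

theorem curvUp_skew (hx : x ∈ U) (i j k l : ι) :
    curvUp b g i j x k l = -curvUp b g i j x l k :=
  congrFun (congrFun (hg.transpose_curv_mul_inv hx i j) l) k

/-- Skewness in both index pairs moves the contraction from the first indices of the pairs to the
second ones. With the last index raised, no metric appears in the sum, so it can be differentiated
term by term. -/
theorem ricciUp_eq (hx : x ∈ U) (a c : ι) :
    ricciUp b g x a c = ∑ k, curvUp b g a k x c k := by
  have h : ∀ k, curvUp b g a k x c k = curvUp b g k a x k c := fun k => by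
    rw [curvUp_swap, Matrix.neg_apply, hg.curvUp_skew hx, neg_neg]
  simp only [h]
  simp only [ricciUp, curvUp, Matrix.mul_apply]
  rw [Finset.sum_comm]
  refine Finset.sum_congr rfl fun e _ => ?_
  rw [← Finset.sum_mul]
  simp only [toMat, Matrix.of_apply]
  rw [hg.ricci_symm hx, hg.ricci_eq]

theorem trace_eq (T : ι → ι → E → ℝ) : trace g T x = (toMat T x * (toMat g x)⁻¹).trace := by
  simp only [trace, Matrix.trace, Matrix.diag, Matrix.mul_apply]
  refine Finset.sum_congr rfl fun i _ => Finset.sum_congr rfl fun j _ => ?_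
  rw [mul_comm, hg.inv_symm]
  rfl

theorem scalar_eq : scalar b g x = ∑ a, ricciUp b g x a a := by
  rw [scalar, hg.trace_eq]
  rfl

theorem contDiffOn_scalar : ContDiffOn ℝ 1 (scalar b g) U := by
  have : scalar b g = fun y => ∑ a, ricciUp b g y a a := funext fun y => hg.scalar_eq
  rw [this]
  exact ContDiffOn.sum fun a _ => hg.cm_ricciUp a a

theorem pd_scalar (hx : x ∈ U) (a : ι) :
    pd b a (scalar b g) x = ∑ c, mpd b a (ricciUp b g) x c c := by
  have : scalar b g = fun y => ∑ c, ricciUp b g y c c := funext fun y => hg.scalar_eq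
  rw [this, pd_sum (f := fun c y => ricciUp b g y c c)
    (fun c _ => hg.cm_ricciUp.differentiableAt hg.isOpen hx one_ne_zero c c)]
  rfl

/-- The covariant derivative of a tensor field with its last index raised. -/
theorem cov2_mul_inv {T : ι → ι → E → ℝ} (hT : CM 1 (toMat T) U) (hx : x ∈ U) (c a d : ι) :
    ∑ e, cov2 b g T c a e x * inv g e d x =
      mpd b c (fun y => toMat T y * (toMat g y)⁻¹) x a d
        - ∑ k, conn b g c x k a * (toMat T x * (toMat g x)⁻¹) k d
        + ∑ k, (toMat T x * (toMat g x)⁻¹) a k * conn b g c x d k := by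
  have h : (mpd b c (toMat T) x - (conn b g c x).transpose * toMat T x
      - toMat T x * conn b g c x) * (toMat g x)⁻¹ =
      mpd b c (fun y => toMat T y * (toMat g y)⁻¹) x
        - (conn b g c x).transpose * (toMat T x * (toMat g x)⁻¹)
        + toMat T x * (toMat g x)⁻¹ * (conn b g c x).transpose := by
    rw [mpd_mul hT hg.cm_inv hg.isOpen hx, hg.mpd_inv hx]
    noncomm_ring
  have h' := congrFun (congrFun h a) d
  rw [Matrix.mul_apply, Matrix.add_apply, Matrix.sub_apply, Matrix.mul_apply (M := Matrix.transpose _),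
    Matrix.mul_apply (N := Matrix.transpose _)] at h'
  simp only [Matrix.transpose_apply] at h'
  rw [← h']
  refine Finset.sum_congr rfl fun e _ => ?_
  rw [cov2_eq]
  rfl

/-- Traces commute with covariant derivatives. -/
theorem pd_trace {T : ι → ι → E → ℝ} (hT : CM 1 (toMat T) U) (hx : x ∈ U) (a : ι) :
    pd b a (trace g T) x = ∑ c, ∑ d, inv g c d x * cov2 b g T a c d x := by
  have h : ∀ c, ∑ d, inv g c d x * cov2 b g T a c d x = _ := fun c =>
    (Finset.sum_congr rfl fun d _ => by rw [mul_comm, hg.inv_symm]).trans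
      (hg.cov2_mul_inv hT hx a c c)
  have hM : CM 1 (fun y => toMat T y * (toMat g y)⁻¹) U :=
    hT.mul (hg.cm_inv.of_le (by norm_num))
  have h0 : trace g T = fun y => ∑ c, (toMat T y * (toMat g y)⁻¹) c c :=
    funext fun y => hg.trace_eq T
  simp only [h]
  rw [h0, pd_sum (f := fun c y => (toMat T y * (toMat g y)⁻¹) c c)
    (fun c _ => hM.differentiableAt hg.isOpen hx one_ne_zero c c),
    Finset.sum_add_distrib, Finset.sum_sub_distrib,
    Finset.sum_comm (f := fun c k => (toMat T x * (toMat g x)⁻¹) c k * conn b g a x c k)]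
  simp only [mul_comm (conn b g a x _ _), sub_add_cancel]
  rfl

/-- The covariant derivative of the curvature with its last index raised, up to the terms from its
first two indices. -/
theorem bianchi_second_up (hx : x ∈ U) (c i j k l : ι) :
    (mpd b c (curvUp b g i j) x + conn b g c x * curvUp b g i j x
        + curvUp b g i j x * (conn b g c x).transpose) k l +
    (mpd b i (curvUp b g j c) x + conn b g i x * curvUp b g j c x
        + curvUp b g j c x * (conn b g i x).transpose) k l +
    (mpd b j (curvUp b g c i) x + conn b g j x * curvUp b g c i x
        + curvUp b g c i x * (conn b g j x).transpose) k l = 0 := by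
  -- Raising an index commutes with the covariant derivative since `∇g⁻¹ = 0`; the claim is thus the
  -- second Bianchi identity times `g⁻¹`.
  have key : ∀ c i j, mpd b c (curvUp b g i j) x + conn b g c x * curvUp b g i j x
        + curvUp b g i j x * (conn b g c x).transpose =
      (mpd b c (curv b (conn b g) i j) x + conn b g c x * curv b (conn b g) i j x
        - curv b (conn b g) i j x * conn b g c x) * (toMat g x)⁻¹ := by
    intro c i j
    unfold curvUp
    rw [mpd_mul (CM.curv hg.cm_conn hg.isOpen i j) hg.cm_inv hg.isOpen hx, hg.mpd_inv hx]
    noncomm_ring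
  rw [key, key, key, ← Matrix.add_apply, ← Matrix.add_apply, ← Matrix.add_mul, ← Matrix.add_mul,
    bianchi_second hg.cm_conn hg.isOpen hx, zero_mul, Matrix.zero_apply]

theorem mpd_curvUp_skew (hx : x ∈ U) (c i j k l : ι) :
    mpd b c (curvUp b g i j) x k l = -mpd b c (curvUp b g i j) x l k := by
  simp only [mpd, Matrix.of_apply]
  rw [pd_congr hg.isOpen hx (fun y hy => hg.curvUp_skew hy i j k l)]
  simp [pd, fderiv_fun_neg]

/-- The contracted Bianchi identity `∇_c R_a^c = ½ ∂_a R`. -/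
theorem bianchi_contracted (hx : x ∈ U) (a : ι) :
    2 * ∑ c, (mpd b c (ricciUp b g) x a c - ∑ k, conn b g c x k a * ricciUp b g x k c
        + ∑ k, ricciUp b g x a k * conn b g c x c k) = pd b a (scalar b g) x := by
  have hΓ : ∀ i j k, conn b g i x k j = conn b g j x k i := fun i j k =>
    hg.christoffel_symm k i j
  have hd : ∀ c a d, mpd b c (ricciUp b g) x a d = ∑ k, mpd b c (curvUp b g a k) x d k := by
    intro c a d
    simp only [mpd, Matrix.of_apply]
    rw [pd_congr hg.isOpen hx (fun y hy => hg.ricciUp_eq hy a d)]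
    exact pd_sum (f := fun k y => curvUp b g a k y d k)
      (fun k _ => (hg.cm_curvUp a k).differentiableAt hg.isOpen hx one_ne_zero d k) c
  -- `Z` is one term of the cyclic identity. Setting `i = a`, `j = l` and contracting `c` and `l`
  -- with the upper pair yields three sums: a divergence, minus a gradient, and the divergence
  -- again.
  set Z : ι → ι → ι → ι → ι → ℝ := fun c i j k l =>
    (mpd b c (curvUp b g i j) x + conn b g c x * curvUp b g i j x
        + curvUp b g i j x * (conn b g c x).transpose) k l with hZ
  have e1 : ∑ c, ∑ l, Z c a l c l = ∑ c, mpd b c (ricciUp b g) x a c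
      + ∑ c, ∑ k, conn b g c x c k * ricciUp b g x a k := by
    -- The curvature is skew in `c, k` while `Γˡ_{ck}` is symmetric.
    have h0 : ∑ c, ∑ l, ∑ k, curvUp b g a l x c k * conn b g c x l k = 0 := by
      rw [Finset.sum_comm]
      refine Finset.sum_eq_zero fun l _ => ?_
      have h : ∑ c, ∑ k, curvUp b g a l x c k * conn b g c x l k =
          -∑ c, ∑ k, curvUp b g a l x c k * conn b g c x l k := by
        conv_lhs => rw [Finset.sum_comm]
        rw [← Finset.sum_neg_distrib]
        refine Finset.sum_congr rfl fun c _ => ?_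
        rw [← Finset.sum_neg_distrib]
        refine Finset.sum_congr rfl fun k _ => ?_
        rw [hg.curvUp_skew hx, hΓ k c l, neg_mul]
      linarith
    simp only [hZ, Matrix.add_apply, Matrix.mul_apply, Matrix.transpose_apply,
      Finset.sum_add_distrib, h0, add_zero, hd]
    congr 1
    refine Finset.sum_congr rfl fun c _ => ?_
    rw [Finset.sum_comm]
    refine Finset.sum_congr rfl fun k _ => ?_
    rw [hg.ricciUp_eq hx, Finset.mul_sum]
  have e2 : ∑ c, ∑ l, Z a l c c l = -∑ c, mpd b a (ricciUp b g) x c c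
      - 2 * ∑ c, ∑ k, conn b g c x k a * ricciUp b g x k c := by
    have h1 : ∑ c, ∑ l, ∑ k, conn b g a x c k * curvUp b g l c x k l =
        -∑ c, ∑ k, conn b g c x k a * ricciUp b g x k c := by
      rw [Finset.sum_comm (f := fun c k => conn b g c x k a * ricciUp b g x k c),
        ← Finset.sum_neg_distrib]
      refine Finset.sum_congr rfl fun c _ => ?_
      rw [Finset.sum_comm, ← Finset.sum_neg_distrib]
      refine Finset.sum_congr rfl fun k _ => ?_
      rw [hg.ricciUp_eq hx, Finset.mul_sum, ← Finset.sum_neg_distrib]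
      refine Finset.sum_congr rfl fun l _ => ?_
      rw [curvUp_swap, hΓ a k c, Matrix.neg_apply, mul_neg]
    have h2 : ∑ c, ∑ l, ∑ k, curvUp b g l c x c k * conn b g a x l k =
        -∑ c, ∑ k, conn b g c x k a * ricciUp b g x k c := by
      rw [Finset.sum_comm, Finset.sum_comm (f := fun c k => conn b g c x k a * ricciUp b g x k c),
        ← Finset.sum_neg_distrib]
      refine Finset.sum_congr rfl fun l _ => ?_
      rw [Finset.sum_comm, ← Finset.sum_neg_distrib]
      refine Finset.sum_congr rfl fun k _ => ?_
      rw [hg.ricciUp_eq hx, Finset.mul_sum, ← Finset.sum_neg_distrib]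
      refine Finset.sum_congr rfl fun c _ => ?_
      rw [hg.curvUp_skew hx, hΓ a k l]
      ring
    have h3 : ∑ c, ∑ l, mpd b a (curvUp b g l c) x c l = -∑ c, mpd b a (ricciUp b g) x c c := by
      simp only [hd, ← Finset.sum_neg_distrib]
      refine Finset.sum_congr rfl fun c _ => Finset.sum_congr rfl fun l _ => ?_
      rw [mpd_curvUp_swap]
    simp only [hZ, Matrix.add_apply, Matrix.mul_apply, Matrix.transpose_apply,
      Finset.sum_add_distrib, h1, h2, h3]
    ring
  -- Exchanging both index pairs costs two signs, so the third sum equals the first.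
  have e3 : ∑ c, ∑ l, Z l c a c l = ∑ c, ∑ l, Z c a l c l := by
    rw [Finset.sum_comm]
    refine Finset.sum_congr rfl fun l _ => Finset.sum_congr rfl fun c _ => ?_
    simp only [hZ, Matrix.add_apply, Matrix.mul_apply, Matrix.transpose_apply]
    rw [mpd_curvUp_swap, hg.mpd_curvUp_skew hx, curvUp_swap c a]
    simp only [Matrix.neg_apply]
    rw [neg_neg, add_assoc, add_assoc, add_comm (∑ k, conn b g l x c k * _)]
    congr 2 <;> refine Finset.sum_congr rfl fun k _ => ?_ <;> rw [hg.curvUp_skew hx] <;> ring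
  have hsum : ∑ c, ∑ l, (Z c a l c l + Z a l c c l + Z l c a c l) = 0 :=
    Finset.sum_eq_zero fun c _ => Finset.sum_eq_zero fun l _ => hg.bianchi_second_up hx c a l c l
  simp only [Finset.sum_add_distrib] at hsum
  rw [e3, e1, e2] at hsum
  rw [hg.pd_scalar hx, Finset.sum_add_distrib, Finset.sum_sub_distrib]
  simp only [mul_comm (ricciUp b g x a _)]
  linarith

/-- The trace of the left-hand side of Yang's equations. -/
theorem trace_yang (hx : x ∈ U) (a : ι) :
    ∑ c, ∑ d, inv g c d x * yang b g a c d x = (1 / 2) * pd b a (scalar b g) x := by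
  have h2 : ∑ c, ∑ d, inv g c d x * cov2 b g (ricci b g) c a d x =
      (1 / 2) * pd b a (scalar b g) x := by
    rw [← hg.bianchi_contracted hx a, ← mul_assoc]
    norm_num only [one_mul]
    refine Finset.sum_congr rfl fun c _ => ?_
    refine Eq.trans ?_ (hg.cov2_mul_inv hg.cm_ricci hx c a c)
    exact Finset.sum_congr rfl fun d _ => by rw [mul_comm, hg.inv_symm]
  simp only [yang, mul_sub, Finset.sum_sub_distrib]
  rw [← hg.pd_trace hg.cm_ricci hx, h2, show trace g (ricci b g) = scalar b g from rfl]
  ring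

end IsMetricOn

end ContractedBianchi

end Coord

/-! ### Pullback of connections, curvature and tensors along a map. -/

namespace Coord

section Pullback

variable {ι κ ι₁ ι₂ E F : Type*} [NormedAddCommGroup E] [NormedSpace ℝ E]
  [NormedAddCommGroup F] [NormedSpace ℝ F] [Fintype ι]
variable {b : ι → E} {b' : κ → F} {φ : F → E} {A : F → Matrix ι κ ℝ} {W : Set F} {U : Set E} {y : F}

/-- `A` is the Jacobian matrix of the `C³` map `φ` from the open set `W` to `U`. -/
structure IsJacobianOn (b : ι → E) (b' : κ → F) (φ : F → E) (A : F → Matrix ι κ ℝ) (W : Set F)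
    (U : Set E) : Prop where
  isOpen : IsOpen W
  mapsTo : ∀ y ∈ W, φ y ∈ U
  contDiffOn : ContDiffOn ℝ 3 φ W
  cm : CM 2 A W
  fderiv_apply : ∀ y ∈ W, ∀ i, fderiv ℝ φ y (b' i) = ∑ a, A y a i • b a
  symm : ∀ y ∈ W, ∀ i j a, mpd b' i A y a j = mpd b' j A y a i

/-- The pullback of the connection matrices `Γ` along `φ`. -/
def pullConn (φ : F → E) (A : F → Matrix ι κ ℝ) (Γ : ι → E → Matrix ι₁ ι₂ ℝ) (i : κ) (y : F) :
    Matrix ι₁ ι₂ ℝ :=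
  ∑ a, A y a i • Γ a (φ y)

namespace IsJacobianOn

variable (hA : IsJacobianOn b b' φ A W U)
include hA

theorem pd_comp {f : E → ℝ} {n : WithTop ℕ∞} (hf : ContDiffOn ℝ n f U) (hU : IsOpen U)
    (hy : y ∈ W) (hn : n ≠ 0 := by norm_num) (i : κ) :
    pd b' i (fun z => f (φ z)) y = ∑ a, A y a i * pd b a f (φ y) := by
  have h1 : DifferentiableAt ℝ f (φ y) :=
    (hf.contDiffAt (hU.mem_nhds (hA.mapsTo y hy))).differentiableAt hn
  have h2 : DifferentiableAt ℝ φ y :=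
    (hA.contDiffOn.contDiffAt (hA.isOpen.mem_nhds hy)).differentiableAt (by norm_num)
  have h3 : fderiv ℝ (fun z => f (φ z)) y = (fderiv ℝ f (φ y)).comp (fderiv ℝ φ y) :=
    fderiv_comp y h1 h2
  rw [pd, h3, ContinuousLinearMap.comp_apply, hA.fderiv_apply y hy]
  simp [pd]

theorem mpd_comp {M : E → Matrix ι₁ ι₂ ℝ} {n : WithTop ℕ∞} (hM : CM n M U) (hU : IsOpen U)
    (hy : y ∈ W) (hn : n ≠ 0 := by norm_num) (i : κ) :
    mpd b' i (fun z => M (φ z)) y = pullConn φ A (fun a => mpd b a M) i y := by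
  ext k l
  simp only [pullConn, Matrix.sum_apply, Matrix.smul_apply, smul_eq_mul]
  exact hA.pd_comp (hM k l) hU hy hn i

theorem cm_comp {M : E → Matrix ι₁ ι₂ ℝ} {n : WithTop ℕ∞} (hM : CM n M U) (hn : n ≤ 3) :
    CM n (fun z => M (φ z)) W :=
  fun k l => (hM k l).comp (hA.contDiffOn.of_le hn) hA.mapsTo

theorem cm_pullConn {Γ : ι → E → Matrix ι₁ ι₂ ℝ} {n : WithTop ℕ∞} (hΓ : ∀ a, CM n (Γ a) U)
    (hn : n ≤ 2) (i : κ) : CM n (pullConn φ A Γ i) W :=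
  CM.sum fun a => CM.smul ((hA.cm a i).of_le hn)
    (hA.cm_comp (hΓ a) (hn.trans (by norm_num)))

/-- Product and chain rule. The first sum contains second derivatives of `φ`; it is symmetric in `i,
j` and so drops out of the curvature. -/
theorem mpd_pullConn {Γ : ι → E → Matrix ι₁ ι₂ ℝ} {n : WithTop ℕ∞} (hΓ : ∀ a, CM n (Γ a) U)
    (hU : IsOpen U) (hy : y ∈ W) (hn : 1 ≤ n) (i j : κ) :
    mpd b' i (pullConn φ A Γ j) y = ∑ a, mpd b' i A y a j • Γ a (φ y)
      + ∑ a, ∑ c, (A y a i * A y c j) • mpd b a (Γ c) (φ y) := by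
  have hΓ1 : ∀ a, CM 1 (Γ a) U := fun a => (hΓ a).of_le hn
  have hd : ∀ a k l, DifferentiableAt ℝ (fun z => Γ a (φ z) k l) y := fun a =>
    (hA.cm_comp (hΓ1 a) (by norm_num)).differentiableAt hA.isOpen hy one_ne_zero
  have hdA : ∀ a j, DifferentiableAt ℝ (fun z => A z a j) y :=
    hA.cm.differentiableAt hA.isOpen hy
  ext k l
  have h1 : mpd b' i (pullConn φ A Γ j) y k l =
      pd b' i (fun z => ∑ a, A z a j * Γ a (φ z) k l) y := by
    simp [mpd, pullConn, Matrix.sum_apply]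
  rw [h1, pd_sum (f := fun a z => A z a j * Γ a (φ z) k l) (fun a _ => (hdA a j).mul (hd a k l))]
  simp only [Matrix.add_apply, Matrix.sum_apply, Matrix.smul_apply, smul_eq_mul]
  rw [Finset.sum_comm (f := fun a c => A y a i * A y c j * mpd b a (Γ c) (φ y) k l),
    ← Finset.sum_add_distrib]
  refine Finset.sum_congr rfl fun a _ => ?_
  rw [pd_mul (hdA a j) (hd a k l), hA.pd_comp (hΓ1 a k l) hU hy one_ne_zero, Finset.mul_sum]
  refine congrArg₂ _ rfl (Finset.sum_congr rfl fun c _ => ?_)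
  simp only [mpd, Matrix.of_apply]
  ring

/-- The curvature of a pulled back connection is the pullback of the curvature. -/
theorem curv_pullConn [Fintype ι₁] {Γ : ι → E → Matrix ι₁ ι₁ ℝ} (hΓ : ∀ a, CM 2 (Γ a) U)
    (hU : IsOpen U) (hy : y ∈ W) (i j : κ) :
    curv b' (pullConn φ A Γ) i j y =
      ∑ a, ∑ c, (A y a i * A y c j) • curv b Γ a c (φ y) := by
  have h1 : ∑ a, mpd b' i A y a j • Γ a (φ y) = ∑ a, mpd b' j A y a i • Γ a (φ y) :=
    Finset.sum_congr rfl fun a _ => by rw [hA.symm y hy]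
  have h2 : ∑ a, ∑ c, (A y a j * A y c i) • mpd b a (Γ c) (φ y) =
      ∑ a, ∑ c, (A y a i * A y c j) • mpd b c (Γ a) (φ y) := by
    rw [Finset.sum_comm]
    exact Finset.sum_congr rfl fun a _ => Finset.sum_congr rfl fun c _ => by rw [mul_comm]
  have h3 : ∀ i j, pullConn φ A Γ i y * pullConn φ A Γ j y =
      ∑ a, ∑ c, (A y a i * A y c j) • (Γ a (φ y) * Γ c (φ y)) := by
    intro i j
    simp only [pullConn, Finset.sum_mul, Finset.mul_sum, Matrix.smul_mul, Matrix.mul_smul,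
      smul_smul]
    rw [Finset.sum_comm]
    exact Finset.sum_congr rfl fun a _ => Finset.sum_congr rfl fun c _ => by rw [mul_comm (A y a i)]
  have h4 : ∑ a, ∑ c, (A y a j * A y c i) • (Γ a (φ y) * Γ c (φ y)) =
      ∑ a, ∑ c, (A y a i * A y c j) • (Γ c (φ y) * Γ a (φ y)) := by
    rw [Finset.sum_comm]
    exact Finset.sum_congr rfl fun a _ => Finset.sum_congr rfl fun c _ => by rw [mul_comm]
  rw [curv, hA.mpd_pullConn hΓ hU hy (by norm_num), hA.mpd_pullConn hΓ hU hy (by norm_num), h1,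
    h2, h3, h3, h4]
  simp only [curv, smul_sub, smul_add, Finset.sum_add_distrib, Finset.sum_sub_distrib]
  abel

end IsJacobianOn

/-- The Gauss and Codazzi equations: the curvature of a connection `Γ'` that is induced by a
connection `Γ` along `A`, with normal `n` and second fundamental form `K`. -/
theorem gauss_codazzi [Fintype κ] {Γ : κ → F → Matrix ι ι ℝ} {Γ' : κ → F → Matrix κ κ ℝ}
    {n : F → Matrix ι Unit ℝ} {K : κ → F → Matrix Unit κ ℝ} (hW : IsOpen W)
    (hA : CM 2 A W) (hΓ : ∀ i, CM 1 (Γ i) W) (hΓ' : ∀ i, CM 1 (Γ' i) W) (hn : CM 1 n W)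
    (hK : ∀ i, CM 1 (K i) W)
    (h : ∀ y ∈ W, ∀ i, A y * Γ' i y = mpd b' i A y + Γ i y * A y - n y * K i y)
    (hy : y ∈ W) (i j : κ) :
    A y * curv b' Γ' i j y = curv b' Γ i j y * A y
      - ((mpd b' i n y + Γ i y * n y) * K j y + n y * (mpd b' i (K j) y + K i y * Γ' j y))
      + ((mpd b' j n y + Γ j y * n y) * K i y + n y * (mpd b' j (K i) y + K j y * Γ' i y)) := by
  have hA1 : CM 1 A W := hA.of_le (by norm_num)
  have hdA : ∀ i, CM 1 (mpd b' i A) W := fun i =>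
    hA.mpd hW (by norm_num [one_add_one_eq_two]) i
  -- This differentiates the structure equation `h` and isolates the term with `∂Γ'`. The second
  -- derivatives of `A` cancel on antisymmetrizing.
  have key : ∀ i j, A y * mpd b' i (Γ' j) y = mpd b' i (mpd b' j A) y
      + (mpd b' i (Γ j) y * A y + Γ j y * mpd b' i A y)
      - (mpd b' i n y * K j y + n y * mpd b' i (K j) y) - mpd b' i A y * Γ' j y := by
    intro i j
    rw [eq_sub_iff_add_eq, add_comm, ← mpd_mul hA1 (hΓ' j) hW hy,
      mpd_congr hW hy (fun z hz => h z hz j),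
      mpd_sub ((hdA j).add ((hΓ j).mul hA1)) (hn.mul (hK j)) hW hy,
      mpd_add (hdA j) ((hΓ j).mul hA1) hW hy, mpd_mul (hΓ j) hA1 hW hy, mpd_mul hn (hK j) hW hy]
  have h' : ∀ i j, A y * (Γ' i y * Γ' j y) = mpd b' i A y * Γ' j y
      + Γ i y * (mpd b' j A y + Γ j y * A y - n y * K j y) - n y * (K i y * Γ' j y) := by
    intro i j
    rw [← Matrix.mul_assoc, h y hy, Matrix.sub_mul, Matrix.add_mul, Matrix.mul_assoc (Γ i y),
      h y hy, Matrix.mul_assoc (n y)]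
  simp only [curv, Matrix.mul_add, Matrix.mul_sub, key, h', mpd_comm hA hW hy j i,
    Matrix.add_mul, Matrix.sub_mul, Matrix.mul_assoc]
  abel

variable {g : ι → ι → E → ℝ} {g' : κ → κ → F → ℝ}

/-- Uniqueness of the Levi-Civita connection. -/
theorem eq_koszul {C : κ → Matrix κ κ ℝ}
    (hs : ∀ i l j, C i l j = C j l i) (hm : ∀ i, mpd b' i (toMat g') y = (C i).transpose + C i)
    (i : κ) : C i = koszul b' g' i y := by
  ext l j
  have h : ∀ i l j, pd b' i (g' l j) y = C i j l + C i l j := fun i l j =>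
    congrFun (congrFun (hm i) l) j
  simp only [koszul, Matrix.of_apply, h]
  rw [hs i j l, hs j l i, hs j i l, hs l i j]
  ring

variable [DecidableEq ι]

namespace IsJacobianOn

variable (hA : IsJacobianOn b b' φ A W U)
include hA

/-- The expression is `∇_i` of the `j`-th tangent vector. It is symmetric because second derivatives
of `φ` commute and the connection has no torsion. -/
theorem symm_mpd_add_conn (hg : IsMetricOn g U) (hy : y ∈ W) (i j : κ) (a : ι) :
    (mpd b' i A y + pullConn φ A (conn b g) i y * A y) a j =
      (mpd b' j A y + pullConn φ A (conn b g) j y * A y) a i := by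
  simp only [Matrix.add_apply, Matrix.mul_apply, pullConn, Matrix.sum_apply, Matrix.smul_apply,
    smul_eq_mul, Finset.sum_mul]
  rw [hA.symm y hy, Finset.sum_comm]
  congr 1
  refine Finset.sum_congr rfl fun c _ => Finset.sum_congr rfl fun d _ => ?_
  have : conn b g c (φ y) a d = conn b g d (φ y) a c := hg.christoffel_symm _ _ _
  rw [this]
  ring

theorem mpd_toMat_comp (hg : IsMetricOn g U) (hy : y ∈ W) (i : κ) :
    mpd b' i (fun z => toMat g (φ z)) y =
      (pullConn φ A (conn b g) i y).transpose * toMat g (φ y)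
        + toMat g (φ y) * pullConn φ A (conn b g) i y := by
  rw [hA.mpd_comp hg.cm_toMat hg.isOpen hy]
  simp only [pullConn, hg.mpd_toMat (hA.mapsTo y hy), Matrix.transpose_sum, Finset.sum_mul,
    Finset.mul_sum, Matrix.transpose_smul, Matrix.smul_mul, Matrix.mul_smul, smul_add,
    Finset.sum_add_distrib]

theorem mpd_inv_comp (hg : IsMetricOn g U) (hy : y ∈ W) (i : κ) :
    mpd b' i (fun z => (toMat g (φ z))⁻¹) y =
      -((toMat g (φ y))⁻¹ * (pullConn φ A (conn b g) i y).transpose)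
        - pullConn φ A (conn b g) i y * (toMat g (φ y))⁻¹ := by
  rw [hA.mpd_comp (M := fun x => (toMat g x)⁻¹) hg.cm_inv hg.isOpen hy]
  simp only [pullConn, hg.mpd_inv (hA.mapsTo y hy), Matrix.transpose_sum, Finset.sum_mul,
    Finset.mul_sum, Matrix.transpose_smul, Matrix.smul_mul, Matrix.mul_smul, smul_sub, smul_neg,
    Finset.sum_sub_distrib, Finset.sum_neg_distrib]

/-- The pullback of the covariant derivative of a tensor field. -/
theorem pullConn_cov2 {T : ι → ι → E → ℝ} (hT : CM 1 (toMat T) U) (hU : IsOpen U) (hy : y ∈ W)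
    (i : κ) :
    pullConn φ A (fun c x => toMat (cov2 b g T c) x) i y =
      mpd b' i (fun z => toMat T (φ z)) y
        - (pullConn φ A (conn b g) i y).transpose * toMat T (φ y)
        - toMat T (φ y) * pullConn φ A (conn b g) i y := by
  have h : ∀ c x, toMat (cov2 b g T c) x = mpd b c (toMat T) x
      - (conn b g c x).transpose * toMat T x - toMat T x * conn b g c x := fun c x => by
    ext a d
    exact cov2_eq T c a d
  rw [hA.mpd_comp hT hU hy]
  simp only [pullConn, h, Matrix.transpose_sum, Finset.sum_mul, Finset.mul_sum,
    Matrix.transpose_smul, Matrix.smul_mul, Matrix.mul_smul, smul_sub, Finset.sum_sub_distrib]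

variable [Fintype κ] [DecidableEq κ]

/-- The induced connection is the tangential part of the pulled back one. -/
theorem transpose_mul_conn (hg : IsMetricOn g U) (hg' : IsMetricOn g' W)
    (h : ∀ y ∈ W, toMat g' y = (A y).transpose * toMat g (φ y) * A y) (hy : y ∈ W) (i : κ) :
    (A y).transpose * toMat g (φ y) * (A y * conn b' g' i y) =
      (A y).transpose * toMat g (φ y) *
        (mpd b' i A y + pullConn φ A (conn b g) i y * A y) := by
  rw [← Matrix.mul_assoc, ← h y hy, hg'.mul_conn hy, eq_comm]
  have hG : CM 3 (fun z => toMat g (φ z)) W := hA.cm_comp hg.cm_toMat le_rfl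
  -- The tangential part `Aᵀ g (∂_i A + Γ_i A)` is symmetric in its two lower indices, and adding
  -- its transpose gives `∂_i g'`; these two properties force it to be the Koszul matrix of `g'`.
  refine eq_koszul (C := fun i => (A y).transpose * toMat g (φ y) *
    (mpd b' i A y + pullConn φ A (conn b g) i y * A y)) (fun i l j => ?_) (fun i => ?_) i
  · rw [Matrix.mul_apply, Matrix.mul_apply]
    exact Finset.sum_congr rfl fun a _ => by rw [hA.symm_mpd_add_conn hg hy]
  · rw [mpd_congr hA.isOpen hy h, mpd_mul (hA.cm.transpose.mul
        (hG.of_le (by norm_num) : CM 2 _ W)) hA.cm hA.isOpen hy,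
      mpd_mul hA.cm.transpose hG hA.isOpen hy, hA.mpd_toMat_comp hg hy, mpd_transpose]
    simp only [Matrix.transpose_mul, Matrix.transpose_add, Matrix.transpose_transpose,
      hg.transpose_toMat, Matrix.add_mul, Matrix.mul_add, Matrix.mul_assoc]
    abel

/-- The covariant derivative of a pulled back tensor field. -/
theorem cov2_pull {T : ι → ι → E → ℝ} {T' : κ → κ → F → ℝ} {i : κ} {n : Matrix ι Unit ℝ}
    {K : Matrix Unit κ ℝ} (hT : CM 1 (toMat T) U) (hU : IsOpen U)
    (h : ∀ y ∈ W, toMat T' y = (A y).transpose * toMat T (φ y) * A y) (hy : y ∈ W)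
    (hΓ : A y * conn b' g' i y = mpd b' i A y + pullConn φ A (conn b g) i y * A y - n * K)
    (j k : κ) :
    cov2 b' g' T' i j k y = ((A y).transpose * pullConn φ A (fun c x => toMat (cov2 b g T c) x) i y * A y
      + (n * K).transpose * toMat T (φ y) * A y
      + (A y).transpose * toMat T (φ y) * (n * K)) j k := by
  have hT' : CM 1 (fun z => toMat T (φ z)) W := hA.cm_comp hT (by norm_num)
  have hA1 : CM 1 A W := hA.cm.of_le (by norm_num)
  have h1 : mpd b' i (toMat T') y = (mpd b' i A y).transpose * toMat T (φ y) * A y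
      + (A y).transpose * mpd b' i (fun z => toMat T (φ z)) y * A y
      + (A y).transpose * toMat T (φ y) * mpd b' i A y := by
    rw [mpd_congr hA.isOpen hy h, mpd_mul (hA1.transpose.mul hT') hA1 hA.isOpen hy,
      mpd_mul hA1.transpose hT' hA.isOpen hy, mpd_transpose, Matrix.add_mul]
  have h3 : (conn b' g' i y).transpose * (A y).transpose =
      (A y * conn b' g' i y).transpose := (Matrix.transpose_mul _ _).symm
  rw [cov2_eq, h1, hA.pullConn_cov2 hT hU hy, h y hy]
  refine congrFun (congrFun ?_ j) k
  rw [Matrix.mul_assoc _ (A y), hΓ, ← Matrix.mul_assoc, ← Matrix.mul_assoc, h3, hΓ]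
  simp only [Matrix.transpose_mul, Matrix.transpose_add, Matrix.transpose_sub, Matrix.add_mul,
    Matrix.mul_add, Matrix.sub_mul, Matrix.mul_sub, Matrix.mul_assoc]
  abel

end IsJacobianOn

end Pullback

end Coord

/-! ### Invariance of the scalar curvature under changes of coordinates. -/

namespace Coord

/-- The Jacobian factors on the form indices move onto the matrix side of the contraction. There
they combine into `A B` and `C Aᵀ`, which are identities for a change of coordinates, and for a
hypersurface the tangential projection and the projected inverse metric. -/
theorem sum_pull {ι κ : Type*} [Fintype ι] [Fintype κ] (A : Matrix ι κ ℝ) (B : Matrix κ ι ℝ)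
    (C : Matrix ι κ ℝ) (P : ι → ι → Matrix ι ι ℝ) :
    ∑ i, ∑ j, (B * (∑ a, ∑ c, (A a i * A c j) • P a c) * C) i j =
      ∑ a, ∑ c, (A * B * P a c * (C * A.transpose)) a c := by
  have h1 : ∀ a c, (A * B * P a c * (C * A.transpose)) a c =
      ∑ i, ∑ j, A a i * A c j * (B * P a c * C) i j := by
    intro a c
    have : A * B * P a c * (C * A.transpose) = A * (B * P a c * C) * A.transpose := by
      simp only [Matrix.mul_assoc]
    rw [this, Matrix.mul_assoc, Matrix.mul_apply]
    refine Finset.sum_congr rfl fun i _ => ?_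
    rw [Matrix.mul_apply, Finset.mul_sum]
    refine Finset.sum_congr rfl fun j _ => ?_
    rw [Matrix.transpose_apply]
    ring
  have h2 : ∀ i j, (B * (∑ a, ∑ c, (A a i * A c j) • P a c) * C) i j =
      ∑ a, ∑ c, A a i * A c j * (B * P a c * C) i j := by
    intro i j
    simp only [Matrix.mul_sum, Matrix.sum_mul, Matrix.mul_smul, Matrix.smul_mul, Matrix.sum_apply,
      Matrix.smul_apply, smul_eq_mul]
  simp only [h1, h2]
  calc _ = ∑ i, ∑ a, ∑ j, ∑ c, A a i * A c j * (B * P a c * C) i j :=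
        Finset.sum_congr rfl fun i _ => Finset.sum_comm
    _ = ∑ a, ∑ i, ∑ j, ∑ c, A a i * A c j * (B * P a c * C) i j := Finset.sum_comm
    _ = ∑ a, ∑ i, ∑ c, ∑ j, A a i * A c j * (B * P a c * C) i j :=
        Finset.sum_congr rfl fun a _ => Finset.sum_congr rfl fun i _ => Finset.sum_comm
    _ = _ := Finset.sum_congr rfl fun a _ => Finset.sum_comm

section Scalar

variable {ι E F : Type*} [NormedAddCommGroup E] [NormedSpace ℝ E]
  [NormedAddCommGroup F] [NormedSpace ℝ F] [Fintype ι] [DecidableEq ι]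
variable {b : ι → E} {U : Set E} {g : ι → ι → E → ℝ}

theorem IsMetricOn.scalar_eq_sum_curvUp (hg : IsMetricOn g U) {x : E} (hx : x ∈ U) :
    scalar b g x = ∑ a, ∑ c, curvUp b g a c x a c := by
  rw [hg.scalar_eq]
  exact Finset.sum_congr rfl fun a _ => hg.ricciUp_eq hx a a

/-- The scalar curvature does not depend on the coordinates. -/
theorem IsJacobianOn.scalar_comp {b' : ι → F} {φ : F → E} {A : F → Matrix ι ι ℝ} {W : Set F}
    (hA : IsJacobianOn b b' φ A W U) {g' : ι → ι → F → ℝ} (hg : IsMetricOn g U)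
    (hg' : IsMetricOn g' W)
    (h : ∀ y ∈ W, toMat g' y = (A y).transpose * toMat g (φ y) * A y) {y : F} (hy : y ∈ W) :
    scalar b' g' y = scalar b g (φ y) := by
  -- The square matrix `A` is invertible because `Aᵀ g A` is.
  have hdet : ∀ z ∈ W, IsUnit (A z).det ∧ IsUnit ((A z).transpose * toMat g (φ z)).det := by
    intro z hz
    have h0 := hg'.det_ne_zero z hz
    rw [h z hz, Matrix.det_mul] at h0
    exact ⟨(right_ne_zero_of_mul h0).isUnit, (left_ne_zero_of_mul h0).isUnit⟩
  -- In equal dimensions there is no normal part, so `gauss_codazzi` applies with `n = 0` and `K =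
  -- 0` and says that the curvature transforms as a tensor.
  have hconn : ∀ z ∈ W, ∀ i, A z * conn b' g' i z =
      mpd b' i A z + pullConn φ A (conn b g) i z * A z - (0 : Matrix ι Unit ℝ) * (0 : Matrix Unit ι ℝ) := by
    intro z hz i
    have h1 := congrArg (fun M => ((A z).transpose * toMat g (φ z))⁻¹ * M)
      (hA.transpose_mul_conn hg hg' h hz i)
    beta_reduce at h1
    rw [Matrix.nonsing_inv_mul_cancel_left _ _ (hdet z hz).2,
      Matrix.nonsing_inv_mul_cancel_left _ _ (hdet z hz).2] at h1
    rw [h1, Matrix.zero_mul, sub_zero]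
  have hz1 : CM 1 (fun _ : F => (0 : Matrix ι Unit ℝ)) W := fun _ _ => contDiffOn_const
  have hz2 : CM 1 (fun _ : F => (0 : Matrix Unit ι ℝ)) W := fun _ _ => contDiffOn_const
  have hcurv : ∀ i j, A y * curv b' (conn b' g') i j y =
      (∑ a, ∑ c, (A y a i * A y c j) • curv b (conn b g) a c (φ y)) * A y := by
    intro i j
    rw [gauss_codazzi hA.isOpen hA.cm (fun i => (hA.cm_pullConn hg.cm_conn le_rfl i).of_le
      (by norm_num)) (fun i => (hg'.cm_conn i).of_le (by norm_num)) hz1 (fun _ => hz2) hconn hy,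
      hA.curv_pullConn hg.cm_conn hg.isOpen hy]
    have : ∀ i, mpd b' i (fun _ : F => (0 : Matrix ι Unit ℝ)) y = 0 := fun i => by
      ext k l
      exact pd_const _ i
    simp [this]
  have hA1 := (hdet y hy).1
  have hup : ∀ i j, curvUp b' g' i j y = (A y)⁻¹ *
      (∑ a, ∑ c, (A y a i * A y c j) • curvUp b g a c (φ y)) * ((A y)⁻¹).transpose := by
    intro i j
    have hinv : (toMat g' y)⁻¹ = (A y)⁻¹ * (toMat g (φ y))⁻¹ * ((A y)⁻¹).transpose := by
      rw [h y hy, Matrix.mul_inv_rev, Matrix.mul_inv_rev, Matrix.transpose_nonsing_inv,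
        Matrix.mul_assoc]
    have h2 : curv b' (conn b' g') i j y = (A y)⁻¹ * (A y * curv b' (conn b' g') i j y) := by
      rw [Matrix.nonsing_inv_mul_cancel_left _ _ hA1]
    rw [curvUp, h2, hcurv, hinv]
    simp only [← Matrix.mul_assoc]
    rw [Matrix.mul_nonsing_inv_cancel_right _ _ hA1]
    simp only [curvUp, Finset.mul_sum, Finset.sum_mul, Matrix.mul_smul, Matrix.smul_mul,
      Matrix.mul_assoc]
  rw [hg'.scalar_eq_sum_curvUp hy, hg.scalar_eq_sum_curvUp (hA.mapsTo y hy)]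
  simp only [hup]
  rw [sum_pull, Matrix.mul_nonsing_inv _ hA1, ← Matrix.transpose_mul,
    Matrix.mul_nonsing_inv _ hA1]
  simp

end Scalar

end Coord

/-! ### Hypersurfaces: Weingarten, Gauss and Codazzi equations. -/

namespace Coord

section Hypersurface

variable {ι κ E F : Type*} [NormedAddCommGroup E] [NormedSpace ℝ E]
  [NormedAddCommGroup F] [NormedSpace ℝ F] [Fintype ι] [DecidableEq ι] [Fintype κ] [DecidableEq κ]
variable {b : ι → E} {b' : κ → F} {φ : F → E} {A : F → Matrix ι κ ℝ} {W : Set F} {U : Set E}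
  {g : ι → ι → E → ℝ} {g' : κ → κ → F → ℝ} {η : F → Matrix Unit ι ℝ} {y : F}

/-- The unit normal vector field along `φ` that corresponds to the conormal field `η`. -/
def nrm (φ : F → E) (g : ι → ι → E → ℝ) (η : F → Matrix Unit ι ℝ) (y : F) : Matrix ι Unit ℝ :=
  (toMat g (φ y))⁻¹ * (η y).transpose

/-- `φ` is a spacelike hypersurface with metric `g'` and unit conormal field `η`. -/
structure IsHypersurfaceOn (b : ι → E) (b' : κ → F) (φ : F → E) (A : F → Matrix ι κ ℝ)
    (W : Set F) (U : Set E) (g : ι → ι → E → ℝ) (g' : κ → κ → F → ℝ)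
    (η : F → Matrix Unit ι ℝ) : Prop where
  jac : IsJacobianOn b b' φ A W U
  metric : IsMetricOn g U
  metric' : IsMetricOn g' W
  toMat_eq : ∀ y ∈ W, toMat g' y = (A y).transpose * toMat g (φ y) * A y
  cm : CM 3 η W
  normal : ∀ y ∈ W, η y * A y = 0
  unit : ∀ y ∈ W, η y * nrm φ g η y = -1
  proj : ∀ y ∈ W, A y * (toMat g' y)⁻¹ * (A y).transpose =
    (toMat g (φ y))⁻¹ + nrm φ g η y * (nrm φ g η y).transpose

/-- The `i`-th row of the second fundamental form `∇η`. -/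
def sff (b : ι → E) (b' : κ → F) (φ : F → E) (A : F → Matrix ι κ ℝ) (g : ι → ι → E → ℝ)
    (η : F → Matrix Unit ι ℝ) (i : κ) (y : F) : Matrix Unit κ ℝ :=
  (mpd b' i η y - η y * pullConn φ A (conn b g) i y) * A y

/-- The second fundamental form. -/
def sffT (b : ι → E) (b' : κ → F) (φ : F → E) (A : F → Matrix ι κ ℝ) (g : ι → ι → E → ℝ)
    (η : F → Matrix Unit ι ℝ) (i j : κ) (y : F) : ℝ :=
  sff b b' φ A g η i y () j

/-- The tangential component `R_{jm} n^m` of the Ricci tensor. -/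
def momentum (b : ι → E) (φ : F → E) (A : F → Matrix ι κ ℝ) (g : ι → ι → E → ℝ)
    (η : F → Matrix Unit ι ℝ) (j : κ) (y : F) : ℝ :=
  ((A y).transpose * toMat (ricci b g) (φ y) * nrm φ g η y) j ()

namespace IsHypersurfaceOn

variable (hS : IsHypersurfaceOn b b' φ A W U g g' η)
include hS

theorem cm_inv_comp : CM 3 (fun z => (toMat g (φ z))⁻¹) W :=
  hS.jac.cm_comp hS.metric.cm_inv le_rfl

theorem cm_nrm : CM 3 (nrm φ g η) W := hS.cm_inv_comp.mul hS.cm.transpose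

theorem cm_pullConn (i : κ) : CM 2 (pullConn φ A (conn b g) i) W :=
  hS.jac.cm_pullConn hS.metric.cm_conn le_rfl i

theorem cm_sff (i : κ) : CM 2 (sff b b' φ A g η i) W :=
  ((hS.cm.mpd hS.jac.isOpen (by norm_num [two_add_one_eq_three]) i).sub
    ((hS.cm.of_le (by norm_num)).mul (hS.cm_pullConn i))).mul hS.jac.cm

theorem isUnit (hy : y ∈ W) : IsUnit (toMat g (φ y)).det :=
  hS.metric.isUnit (hS.jac.mapsTo y hy)

theorem transpose_nrm :
    (nrm φ g η y).transpose = η y * (toMat g (φ y))⁻¹ := by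
  rw [nrm, Matrix.transpose_mul, Matrix.transpose_transpose, hS.metric.transpose_inv]

/-- The projection to the hypersurface. -/
theorem proj_mul (hy : y ∈ W) : A y * (toMat g' y)⁻¹ * ((A y).transpose * toMat g (φ y)) =
    1 + nrm φ g η y * η y := by
  rw [← Matrix.mul_assoc, hS.proj y hy, Matrix.add_mul, Matrix.nonsing_inv_mul _ (hS.isUnit hy),
    hS.transpose_nrm, Matrix.mul_assoc, Matrix.mul_assoc,
    Matrix.nonsing_inv_mul _ (hS.isUnit hy), Matrix.mul_one]

theorem transpose_mul_nrm (hy : y ∈ W) :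
    (A y).transpose * (toMat g (φ y) * nrm φ g η y) = 0 := by
  rw [nrm, Matrix.mul_nonsing_inv_cancel_left _ _ (hS.isUnit hy), ← Matrix.transpose_mul,
    hS.normal y hy, Matrix.transpose_zero]

theorem left_inv (hy : y ∈ W) :
    (toMat g' y)⁻¹ * ((A y).transpose * toMat g (φ y)) * A y = 1 := by
  rw [Matrix.mul_assoc, ← hS.toMat_eq y hy, Matrix.nonsing_inv_mul _ (hS.metric'.isUnit hy)]

/-- Differentiate `η A = 0`. This form exhibits `K` as the normal part of the derivative of the
tangent vectors, from which its symmetry is read off. -/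
theorem sff_eq (hy : y ∈ W) (i : κ) : sff b b' φ A g η i y =
    -(η y * (mpd b' i A y + pullConn φ A (conn b g) i y * A y)) := by
  have h0 : mpd b' i (fun z => η z * A z) y = 0 := by
    rw [mpd_congr (N := fun _ => 0) hS.jac.isOpen hy hS.normal]
    ext k l
    exact pd_const _ i
  rw [mpd_mul hS.cm hS.jac.cm hS.jac.isOpen hy] at h0
  rw [sff, Matrix.sub_mul, eq_neg_of_add_eq_zero_left h0, Matrix.mul_add, Matrix.mul_assoc]
  abel

theorem sffT_symm (hy : y ∈ W) (i j : κ) :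
    sffT b b' φ A g η i j y = sffT b b' φ A g η j i y := by
  rw [sffT, sffT, hS.sff_eq hy, hS.sff_eq hy, Matrix.neg_apply, Matrix.neg_apply,
    Matrix.mul_apply, Matrix.mul_apply]
  exact congrArg _ (Finset.sum_congr rfl fun a _ => by
    rw [hS.jac.symm_mpd_add_conn hS.metric hy])

/-- The induced connection. -/
theorem mul_conn (hy : y ∈ W) (i : κ) : A y * conn b' g' i y =
    mpd b' i A y + pullConn φ A (conn b g) i y * A y - nrm φ g η y * sff b b' φ A g η i y := by
  -- The factor `A g'⁻¹` turns `Aᵀ g` into the projection `1 + n η`; by `sff_eq`, its part `n η`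
  -- produces the term `-n K`.
  have h1 := congrArg (fun M => A y * (toMat g' y)⁻¹ * M)
    (hS.jac.transpose_mul_conn hS.metric hS.metric' hS.toMat_eq hy i)
  beta_reduce at h1
  have h2 : (1 + nrm φ g η y * η y) * A y = A y := by
    rw [Matrix.add_mul, Matrix.mul_assoc, hS.normal y hy, Matrix.mul_zero, Matrix.one_mul, add_zero]
  rw [← Matrix.mul_assoc, ← Matrix.mul_assoc _ _ (mpd b' i A y + _), hS.proj_mul hy,
    ← Matrix.mul_assoc, h2, Matrix.add_mul, Matrix.one_mul] at h1
  rw [h1, hS.sff_eq hy, Matrix.mul_neg, sub_neg_eq_add, Matrix.mul_assoc]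

/-- Differentiating `η g⁻¹ ηᵀ = -1` gives `X + Xᵀ = 0` for the `1 × 1` matrix `X` in question, which
equals its own transpose. -/
theorem deriv_conormal_mul_nrm (hy : y ∈ W) (i : κ) :
    (mpd b' i η y - η y * pullConn φ A (conn b g) i y) * nrm φ g η y = 0 := by
  have h0 : mpd b' i (fun z => η z * nrm φ g η z) y = 0 := by
    rw [mpd_congr (N := fun _ => -1) hS.jac.isOpen hy hS.unit]
    ext k l
    exact pd_const _ i
  unfold nrm at h0
  rw [mpd_mul hS.cm (hS.cm_inv_comp.mul hS.cm.transpose) hS.jac.isOpen hy,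
    mpd_mul hS.cm_inv_comp hS.cm.transpose hS.jac.isOpen hy,
    hS.jac.mpd_inv_comp hS.metric hy, mpd_transpose] at h0
  set X := (mpd b' i η y - η y * pullConn φ A (conn b g) i y) * nrm φ g η y with hX
  have h1 : X + X.transpose = 0 := by
    rw [← h0, hX, Matrix.transpose_mul, hS.transpose_nrm, nrm]
    simp only [Matrix.transpose_sub, Matrix.transpose_mul, Matrix.sub_mul, Matrix.mul_sub,
      Matrix.mul_add, Matrix.neg_mul, Matrix.mul_neg, Matrix.mul_assoc]
    abel
  ext u v
  have h2 := congrFun (congrFun h1 u) v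
  rw [Matrix.add_apply, Matrix.transpose_apply, Subsingleton.elim v u, Matrix.zero_apply] at h2
  rw [Subsingleton.elim v u, Matrix.zero_apply]
  linarith

/-- The Weingarten equation. -/
theorem deriv_nrm (hy : y ∈ W) (i : κ) :
    mpd b' i (nrm φ g η) y + pullConn φ A (conn b g) i y * nrm φ g η y =
      A y * ((toMat g' y)⁻¹ * (sff b b' φ A g η i y).transpose) := by
  have h1 : mpd b' i (nrm φ g η) y + pullConn φ A (conn b g) i y * nrm φ g η y =
      (toMat g (φ y))⁻¹ *
        (mpd b' i η y - η y * pullConn φ A (conn b g) i y).transpose := by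
    have : mpd b' i (nrm φ g η) y =
        mpd b' i (fun z => (toMat g (φ z))⁻¹ * (η z).transpose) y := rfl
    rw [this, mpd_mul hS.cm_inv_comp hS.cm.transpose hS.jac.isOpen hy,
      hS.jac.mpd_inv_comp hS.metric hy, mpd_transpose, nrm]
    simp only [Matrix.transpose_sub, Matrix.transpose_mul, Matrix.sub_mul, Matrix.mul_sub,
      Matrix.neg_mul, Matrix.mul_assoc]
    abel
  have h2 := congrArg Matrix.transpose (hS.deriv_conormal_mul_nrm hy i)
  rw [Matrix.transpose_mul, Matrix.transpose_zero] at h2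
  -- Since `∇_i n` has no normal component, `g⁻¹` may be replaced by the projected inverse metric `A
  -- g'⁻¹ Aᵀ`.
  rw [h1, sff, Matrix.transpose_mul, ← Matrix.mul_assoc, ← Matrix.mul_assoc, hS.proj y hy,
    Matrix.add_mul, Matrix.mul_assoc (nrm φ g η y), h2, Matrix.mul_zero, add_zero]

/-- The Weingarten equation is inserted here, so that left multiplication by `η` extracts the
Codazzi equation and by `g'⁻¹ Aᵀ g` the Gauss equation. -/
theorem gauss_codazzi_aux (hy : y ∈ W) (i j : κ) :
    A y * curv b' (conn b' g') i j y =
      (∑ a, ∑ c, (A y a i * A y c j) • curv b (conn b g) a c (φ y)) * A y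
      - (A y * ((toMat g' y)⁻¹ * (sff b b' φ A g η i y).transpose) * sff b b' φ A g η j y
        + nrm φ g η y * (mpd b' i (sff b b' φ A g η j) y + sff b b' φ A g η i y * conn b' g' j y))
      + (A y * ((toMat g' y)⁻¹ * (sff b b' φ A g η j y).transpose) * sff b b' φ A g η i y
        + nrm φ g η y *
          (mpd b' j (sff b b' φ A g η i) y + sff b b' φ A g η j y * conn b' g' i y)) := by
  rw [gauss_codazzi hS.jac.isOpen hS.jac.cm (fun i => (hS.cm_pullConn i).of_le (by norm_num))
    (fun i => (hS.metric'.cm_conn i).of_le (by norm_num)) (hS.cm_nrm.of_le (by norm_num))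
    (fun i => (hS.cm_sff i).of_le (by norm_num)) (fun z hz i => hS.mul_conn hz i) hy,
    hS.jac.curv_pullConn hS.metric.cm_conn hS.metric.isOpen hy, hS.deriv_nrm hy, hS.deriv_nrm hy]

/-- The Codazzi equation, in matrix form. -/
theorem codazzi_mat (hy : y ∈ W) (i j : κ) :
    (mpd b' i (sff b b' φ A g η j) y + sff b b' φ A g η i y * conn b' g' j y)
      - (mpd b' j (sff b b' φ A g η i) y + sff b b' φ A g η j y * conn b' g' i y) =
    -(η y * (∑ a, ∑ c, (A y a i * A y c j) • curv b (conn b g) a c (φ y)) * A y) := by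
  have h := congrArg (fun M => η y * M) (hS.gauss_codazzi_aux hy i j)
  simp only [← Matrix.mul_assoc, Matrix.mul_add, Matrix.mul_sub, hS.normal y hy, hS.unit y hy,
    Matrix.zero_mul, zero_add, Matrix.neg_mul, Matrix.one_mul] at h
  simp only [Matrix.mul_assoc] at h ⊢
  rw [← sub_eq_zero, h]
  abel

/-- The Gauss equation. -/
theorem gauss (hy : y ∈ W) (i j : κ) : curv b' (conn b' g') i j y =
    (toMat g' y)⁻¹ * ((A y).transpose * toMat g (φ y)) *
      (∑ a, ∑ c, (A y a i * A y c j) • curv b (conn b g) a c (φ y)) * A y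
    - (toMat g' y)⁻¹ * (sff b b' φ A g η i y).transpose * sff b b' φ A g η j y
    + (toMat g' y)⁻¹ * (sff b b' φ A g η j y).transpose * sff b b' φ A g η i y := by
  have h := congrArg (fun M => (toMat g' y)⁻¹ * ((A y).transpose * toMat g (φ y)) * M)
    (hS.gauss_codazzi_aux hy i j)
  have hn : (toMat g' y)⁻¹ * ((A y).transpose * toMat g (φ y)) * nrm φ g η y = 0 := by
    rw [Matrix.mul_assoc, Matrix.mul_assoc, hS.transpose_mul_nrm hy, Matrix.mul_zero]
  beta_reduce at h
  rw [← Matrix.mul_assoc, hS.left_inv hy, Matrix.one_mul] at h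
  rw [h]
  simp only [Matrix.mul_add, Matrix.mul_sub]
  simp only [← Matrix.mul_assoc _ (nrm φ g η y), hn, Matrix.zero_mul, add_zero]
  simp only [← Matrix.mul_assoc _ (A y), Matrix.mul_assoc (A y), hS.left_inv hy, Matrix.one_mul]
  simp only [Matrix.mul_assoc]

end IsHypersurfaceOn

end Hypersurface

end Coord

/-! ### Contracted Gauss–Codazzi equations and the projections of Yang's equations. -/

namespace Coord

section Constraints

section

variable {ι κ E F : Type*} [NormedAddCommGroup E] [NormedSpace ℝ E] [Fintype ι] [DecidableEq ι]
  {A : F → Matrix ι κ ℝ}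
  {b : ι → E} {φ : F → E} {g : ι → ι → E → ℝ} {η : F → Matrix Unit ι ℝ} {y : F}

theorem toMat_ricci_mul_nrm :
    toMat (ricci b g) (φ y) * nrm φ g η y = ricciUp b g (φ y) * (η y).transpose := by
  rw [nrm, ricciUp, Matrix.mul_assoc]

theorem momentum_eq (j : κ) : momentum b φ A g η j y =
    ∑ c, A y c j * ∑ m, ricciUp b g (φ y) c m * η y () m := by
  rw [momentum, Matrix.mul_assoc, toMat_ricci_mul_nrm, Matrix.mul_apply]
  rfl

end

variable {ι κ E F : Type*} [NormedAddCommGroup E] [NormedSpace ℝ E]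
  [NormedAddCommGroup F] [NormedSpace ℝ F] [Fintype ι] [DecidableEq ι] [Fintype κ] [DecidableEq κ]
variable {b : ι → E} {b' : κ → F} {φ : F → E} {A : F → Matrix ι κ ℝ} {W : Set F} {U : Set E}
  {g : ι → ι → E → ℝ} {g' : κ → κ → F → ℝ} {η : F → Matrix Unit ι ℝ} {y : F}

namespace IsMetricOn

variable (hg : IsMetricOn g U) {x : E}
include hg

/-- The contraction hits the first form index, whereas `ricciUp_eq` contracts the second; hence the
minus sign. -/
theorem sum_row_mul_curvUp (hx : x ∈ U) (e : Matrix Unit ι ℝ) (c : ι) :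
    ∑ a, (e * curvUp b g a c x) () a = -∑ m, ricciUp b g x c m * e () m := by
  simp only [Matrix.mul_apply]
  rw [Finset.sum_comm, ← Finset.sum_neg_distrib]
  refine Finset.sum_congr rfl fun m _ => ?_
  rw [← Finset.mul_sum, hg.ricciUp_eq hx, mul_comm, ← neg_mul, ← Finset.sum_neg_distrib]
  congr 1
  exact Finset.sum_congr rfl fun a _ => by rw [curvUp_swap]; rfl

/-- A skew `1 × 1` matrix is zero. -/
theorem row_curvUp_row (hx : x ∈ U) (e : Matrix Unit ι ℝ) (a c : ι) :
    e * (curvUp b g a c x * e.transpose) = 0 := by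
  have h : (e * (curvUp b g a c x * e.transpose)).transpose =
      -(e * (curvUp b g a c x * e.transpose)) := by
    rw [Matrix.transpose_mul, Matrix.transpose_mul, Matrix.transpose_transpose, curvUp,
      hg.transpose_curv_mul_inv hx, Matrix.mul_neg, Matrix.neg_mul, Matrix.mul_assoc]
  ext u v
  have h2 := congrFun (congrFun h u) v
  rw [Matrix.neg_apply, Matrix.transpose_apply, Subsingleton.elim v u] at h2
  rw [Subsingleton.elim v u, Matrix.zero_apply]
  linarith

end IsMetricOn

namespace IsHypersurfaceOn

variable (hS : IsHypersurfaceOn b b' φ A W U g g' η)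
include hS

/-- The Codazzi equation. -/
theorem codazzi (hy : y ∈ W) (i j k : κ) :
    cov2 b' g' (sffT b b' φ A g η) i j k y - cov2 b' g' (sffT b b' φ A g η) j i k y =
      -(η y * (∑ a, ∑ c, (A y a i * A y c j) • curv b (conn b g) a c (φ y)) * A y) () k := by
  rw [← Matrix.neg_apply, ← hS.codazzi_mat hy]
  have h : ∑ k_1, christoffel b' g' k_1 i j y * sffT b b' φ A g η k_1 k y =
      ∑ k_1, christoffel b' g' k_1 j i y * sffT b b' φ A g η k_1 k y :=
    Finset.sum_congr rfl fun l _ => by rw [hS.metric'.christoffel_symm]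
  simp only [cov2, Matrix.sub_apply, Matrix.add_apply, Matrix.mul_apply, mpd, Matrix.of_apply, conn]
  rw [h]
  simp only [sffT, mul_comm]
  change pd b' i (fun y => sff b b' φ A g η j y () k) y - _ - _
    - (pd b' j (fun y => sff b b' φ A g η i y () k) y - _ - _) = _
  ring

theorem cm_sffT : CM 2 (toMat (sffT b b' φ A g η)) W := fun i j => hS.cm_sff i () j

/-- The contracted Codazzi equation `D^d K_{jd} - D_j K = R_{jm} n^m`. -/
theorem codazzi_contracted (hy : y ∈ W) (j : κ) :
    div2 b' g' (sffT b b' φ A g η) j y - pd b' j (trace g' (sffT b b' φ A g η)) y =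
      momentum b φ A g η j y := by
  have h1 : div2 b' g' (sffT b b' φ A g η) j y =
      ∑ i, ∑ k, inv g' i k y * cov2 b' g' (sffT b b' φ A g η) i j k y := by
    rw [div2, Finset.sum_comm]
    exact Finset.sum_congr rfl fun i _ => Finset.sum_congr rfl fun k _ => by
      rw [hS.metric'.inv_symm]
  have h2 : ∀ i, ∑ k, inv g' i k y * (cov2 b' g' (sffT b b' φ A g η) i j k y
      - cov2 b' g' (sffT b b' φ A g η) j i k y) =
      -∑ a, ∑ c, A y a i * A y c j *
        (η y * curv b (conn b g) a c (φ y) * (A y * (toMat g' y)⁻¹)) () i := by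
    intro i
    have h3 : ∀ k, inv g' i k y * (cov2 b' g' (sffT b b' φ A g η) i j k y
      - cov2 b' g' (sffT b b' φ A g η) j i k y) =
      -((η y * (∑ a, ∑ c, (A y a i * A y c j) • curv b (conn b g) a c (φ y)) * A y) () k
        * (toMat g' y)⁻¹ k i) := by
      intro k
      rw [hS.codazzi hy, hS.metric'.inv_symm, mul_comm, neg_mul]
      rfl
    simp only [h3]
    rw [Finset.sum_neg_distrib, ← Matrix.mul_apply]
    simp only [Matrix.mul_sum, Matrix.sum_mul, Matrix.mul_smul, Matrix.smul_mul, Matrix.sum_apply,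
      Matrix.smul_apply, smul_eq_mul, Matrix.mul_assoc]
  rw [h1, hS.metric'.pd_trace (hS.cm_sffT.of_le (by norm_num)) hy, ← Finset.sum_sub_distrib]
  simp only [← Finset.sum_sub_distrib, ← mul_sub, h2]
  have h4 : ∀ a c, ∑ i, A y a i * A y c j *
      (η y * curv b (conn b g) a c (φ y) * (A y * (toMat g' y)⁻¹)) () i =
      A y c j * (η y * curvUp b g a c (φ y)) () a := by
    intro a c
    -- Replacing `g⁻¹` by `A g'⁻¹ Aᵀ` costs a term with the normal in both slots of the curvature,
    -- and that term vanishes by skewness.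
    have h5 : η y * curvUp b g a c (φ y) =
        η y * curv b (conn b g) a c (φ y) * (A y * (toMat g' y)⁻¹) * (A y).transpose := by
      have h6 := hS.metric.row_curvUp_row (b := b) (hS.jac.mapsTo y hy) (η y) a c
      rw [curvUp, Matrix.mul_assoc, ← nrm] at h6
      rw [Matrix.mul_assoc _ _ (A y).transpose, hS.proj y hy, Matrix.mul_add, ← Matrix.mul_assoc _
        (nrm φ g η y), Matrix.mul_assoc (η y) _ (nrm φ g η y), h6, Matrix.zero_mul, add_zero,
        curvUp, Matrix.mul_assoc]
    rw [h5, Matrix.mul_apply, Finset.mul_sum]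
    exact Finset.sum_congr rfl fun i _ => by rw [Matrix.transpose_apply]; ring
  rw [Finset.sum_neg_distrib, Finset.sum_comm]
  simp only [Finset.sum_comm (γ := κ), h4]
  rw [Finset.sum_comm, momentum_eq, ← Finset.sum_neg_distrib]
  refine Finset.sum_congr rfl fun c _ => ?_
  rw [← Finset.mul_sum, hS.metric.sum_row_mul_curvUp (hS.jac.mapsTo y hy)]
  ring

/-- The double trace of the curvature over the tangent space of the hypersurface; the last sum is the
normal component `R_{ab} n^a n^b` of the Ricci tensor. -/
theorem sum_curv_proj (hy : y ∈ W) :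
    ∑ a, ∑ c, ((1 + nrm φ g η y * η y) * curv b (conn b g) a c (φ y) *
      ((toMat g (φ y))⁻¹ + nrm φ g η y * (nrm φ g η y).transpose) : Matrix ι ι ℝ) a c =
    scalar b g (φ y) + 2 * ∑ a, nrm φ g η y a () * ∑ m, ricciUp b g (φ y) a m * η y () m := by
  have hx := hS.jac.mapsTo y hy
  -- Of the four terms of the product, the one with the normal on both sides vanishes by skewness.
  -- The other three give the scalar curvature and twice `Ric(n,n)`.
  have h1 : ∀ a c, (1 + nrm φ g η y * η y) * curv b (conn b g) a c (φ y) *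
      ((toMat g (φ y))⁻¹ + nrm φ g η y * (nrm φ g η y).transpose) =
      curvUp b g a c (φ y) + nrm φ g η y * (η y * curvUp b g a c (φ y))
        + curvUp b g a c (φ y) * (η y).transpose * (nrm φ g η y).transpose := by
    intro a c
    have h6 := hS.metric.row_curvUp_row (b := b) hx (η y) a c
    have h7 : curv b (conn b g) a c (φ y) * nrm φ g η y =
        curvUp b g a c (φ y) * (η y).transpose := by
      rw [curvUp, nrm, Matrix.mul_assoc]
    have h8 : curv b (conn b g) a c (φ y) * ((toMat g (φ y))⁻¹
        + nrm φ g η y * (nrm φ g η y).transpose) = curvUp b g a c (φ y)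
        + curvUp b g a c (φ y) * (η y).transpose * (nrm φ g η y).transpose := by
      rw [Matrix.mul_add, ← h7, curvUp, Matrix.mul_assoc]
    rw [Matrix.mul_assoc, h8, Matrix.add_mul, Matrix.one_mul, Matrix.mul_assoc (nrm φ g η y),
      Matrix.mul_add (η y), ← Matrix.mul_assoc (η y) _ (nrm φ g η y).transpose, h6, Matrix.zero_mul,
      add_zero]
    abel
  have h2 : ∀ (n : Matrix ι Unit ℝ) (M : Matrix Unit ι ℝ) a c, (n * M) a c = n a () * M () c :=
    fun n M a c => by simp [Matrix.mul_apply]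
  simp only [h1, Matrix.add_apply, Finset.sum_add_distrib]
  rw [← hS.metric.scalar_eq_sum_curvUp hx, add_assoc, two_mul]
  congr 2
  · refine Finset.sum_congr rfl fun a _ => ?_
    simp only [h2, ← Finset.mul_sum]
    congr 1
    simp only [Matrix.mul_apply]
    rw [Finset.sum_comm]
    refine Finset.sum_congr rfl fun m _ => ?_
    rw [← Finset.mul_sum, hS.metric.ricciUp_eq hx, mul_comm]
  · rw [Finset.sum_comm]
    refine Finset.sum_congr rfl fun c _ => ?_
    simp only [h2, ← Finset.sum_mul, Matrix.transpose_apply]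
    rw [mul_comm]
    congr 1
    simp only [Matrix.mul_apply, Matrix.transpose_apply]
    rw [Finset.sum_comm]
    refine Finset.sum_congr rfl fun m _ => ?_
    rw [← Finset.sum_mul, hS.metric.ricciUp_eq hx]
    congr 1
    refine Finset.sum_congr rfl fun a _ => ?_
    rw [curvUp_swap, Matrix.neg_apply, hS.metric.curvUp_skew hx, neg_neg]

/-- The contracted Gauss equation. -/
theorem gauss_contracted (hy : y ∈ W) :
    scalar b' g' y + trace g' (sffT b b' φ A g η) y ^ 2 - normSq g' (sffT b b' φ A g η) y =
      scalar b g (φ y) + 2 * ∑ a, nrm φ g η y a () * ∑ m, ricciUp b g (φ y) a m * η y () m := by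
  have hsymm : ((toMat g' y)⁻¹).transpose = (toMat g' y)⁻¹ := hS.metric'.transpose_inv
  have h1 : ∀ i j, curvUp b' g' i j y =
      (toMat g' y)⁻¹ * ((A y).transpose * toMat g (φ y)) *
      (∑ a, ∑ c, (A y a i * A y c j) • curv b (conn b g) a c (φ y)) * (A y * (toMat g' y)⁻¹)
      - (sff b b' φ A g η i y * (toMat g' y)⁻¹).transpose
        * (sff b b' φ A g η j y * (toMat g' y)⁻¹)
      + (sff b b' φ A g η j y * (toMat g' y)⁻¹).transpose
        * (sff b b' φ A g η i y * (toMat g' y)⁻¹) := by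
    intro i j
    rw [curvUp, hS.gauss hy, Matrix.transpose_mul, Matrix.transpose_mul, hsymm]
    simp only [Matrix.add_mul, Matrix.sub_mul, Matrix.mul_assoc]
  have h2 : ∀ (n m : Matrix Unit κ ℝ) a c, (n.transpose * m) a c = n () a * m () c :=
    fun n M a c => by simp [Matrix.mul_apply]
  have h3 : trace g' (sffT b b' φ A g η) y =
      ∑ i, (sff b b' φ A g η i y * (toMat g' y)⁻¹) () i := by
    rw [hS.metric'.trace_eq]
    rfl
  -- The Gauss equation contracts to `K_j^i K_i^j`; this is the squared norm because `K` is
  -- symmetric.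
  have h4 : normSq g' (sffT b b' φ A g η) y =
      ∑ i, ∑ j, (sff b b' φ A g η j y * (toMat g' y)⁻¹) () i
        * (sff b b' φ A g η i y * (toMat g' y)⁻¹) () j := by
    rw [normSq]
    refine Finset.sum_congr rfl fun i _ => ?_
    simp only [Matrix.mul_apply, Finset.sum_mul_sum]
    calc _ = ∑ l, ∑ j, ∑ k, inv g' i k y * inv g' l j y * sffT b b' φ A g η i l y *
            sffT b b' φ A g η k j y :=
          Finset.sum_congr rfl fun l _ => Finset.sum_comm
      _ = ∑ j, ∑ l, ∑ k, inv g' i k y * inv g' l j y * sffT b b' φ A g η i l y *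
            sffT b b' φ A g η k j y := Finset.sum_comm
      _ = ∑ j, ∑ k, ∑ l, inv g' i k y * inv g' l j y * sffT b b' φ A g η i l y *
            sffT b b' φ A g η k j y := Finset.sum_congr rfl fun j _ => Finset.sum_comm
      _ = _ := by
        refine Finset.sum_congr rfl fun j _ => Finset.sum_congr rfl fun k _ =>
          Finset.sum_congr rfl fun l _ => ?_
        rw [hS.sffT_symm hy k j, hS.metric'.inv_symm i k]
        simp only [sffT, inv, toMat]
        ring
  rw [hS.metric'.scalar_eq_sum_curvUp hy, ← hS.sum_curv_proj hy]
  simp only [h1, Matrix.add_apply, Matrix.sub_apply, Finset.sum_add_distrib,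
    Finset.sum_sub_distrib]
  -- The ambient curvature is now contracted with projections on both sides, which is the sum in
  -- `sum_curv_proj`; the remaining terms are `-K²` and `K_{ab}K^{ab}`.
  rw [sum_pull, ← Matrix.mul_assoc (A y), hS.proj_mul hy, hS.proj y hy]
  simp only [h2]
  rw [← h4, ← Finset.sum_mul_sum, ← h3]
  ring

/-- Cyclicity of the trace replaces `g'⁻¹` by `A g'⁻¹ Aᵀ = g⁻¹ + n nᵀ`, whose second term
contributes `Ric(n,n)`. -/
theorem trace_ricci_pull {N : κ → κ → F → ℝ}
    (hN : toMat N y = (A y).transpose * toMat (ricci b g) (φ y) * A y) (hy : y ∈ W) :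
    trace g' N y = scalar b g (φ y)
      + ∑ a, nrm φ g η y a () * ∑ m, ricciUp b g (φ y) a m * η y () m := by
  rw [hS.metric'.trace_eq, hN, Matrix.mul_assoc, Matrix.mul_assoc, Matrix.trace_mul_comm,
    Matrix.mul_assoc, hS.proj y hy, Matrix.mul_add, Matrix.trace_add, hS.metric.scalar_eq,
    ← Matrix.mul_assoc, toMat_ricci_mul_nrm]
  refine congrArg₂ _ rfl (Finset.sum_congr rfl fun a _ => ?_)
  simp [Matrix.mul_apply, mul_comm]

/-- The left-hand side of the scalar constraint is minus the scalar curvature of spacetime. -/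
theorem scalar_constraint {N : κ → κ → F → ℝ}
    (hN : toMat N y = (A y).transpose * toMat (ricci b g) (φ y) * A y) (hy : y ∈ W) :
    scalar b' g' y + trace g' (sffT b b' φ A g η) y ^ 2 - normSq g' (sffT b b' φ A g η) y
      - 2 * trace g' N y = -scalar b g (φ y) := by
  rw [hS.gauss_contracted hy, hS.trace_ricci_pull hN hy]
  ring

/-- The tangential part of Yang's equations. -/
theorem yang_tangential {N : κ → κ → F → ℝ}
    (hN : ∀ y ∈ W, toMat N y = (A y).transpose * toMat (ricci b g) (φ y) * A y) (hy : y ∈ W)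
    (i j k : κ) :
    ((A y).transpose * pullConn φ A (fun c x => toMat (cov2 b g (ricci b g) c) x) i y * A y) j k
      - ((A y).transpose * pullConn φ A (fun c x => toMat (cov2 b g (ricci b g) c) x) j y * A y) i k
      = cov2 b' g' N i j k y - cov2 b' g' N j i k y
        - (sffT b b' φ A g η i k y * momentum b φ A g η j y
          - sffT b b' φ A g η j k y * momentum b φ A g η i y) := by
  have hT := hS.metric.cm_ricci (b := b)
  have h1 : (A y).transpose * toMat (ricci b g) (φ y) * nrm φ g η y =
      ((nrm φ g η y).transpose * toMat (ricci b g) (φ y) * A y).transpose := by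
    have : (toMat (ricci b g) (φ y)).transpose = toMat (ricci b g) (φ y) := by
      ext p q
      exact hS.metric.ricci_symm (hS.jac.mapsTo y hy) q p
    rw [Matrix.transpose_mul, Matrix.transpose_mul, Matrix.transpose_transpose, this,
      Matrix.mul_assoc]
  have h2 : ∀ i j k, ((nrm φ g η y * sff b b' φ A g η i y).transpose * toMat (ricci b g) (φ y) * A y) j k
      = sffT b b' φ A g η i j y * momentum b φ A g η k y := by
    intro i j k
    rw [Matrix.transpose_mul, momentum, h1, Matrix.mul_assoc, Matrix.mul_assoc,
      Matrix.mul_apply]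
    simp [sffT, Matrix.mul_assoc]
  have h3 : ∀ i j k, ((A y).transpose * toMat (ricci b g) (φ y) * (nrm φ g η y * sff b b' φ A g η i y)) j k
      = momentum b φ A g η j y * sffT b b' φ A g η i k y := by
    intro i j k
    rw [← Matrix.mul_assoc, Matrix.mul_apply]
    simp [sffT, momentum]
  rw [hS.jac.cov2_pull hT hS.metric.isOpen hN hy (hS.mul_conn hy i),
    hS.jac.cov2_pull hT hS.metric.isOpen hN hy (hS.mul_conn hy j)]
  simp only [Matrix.add_apply, h2, h3]
  -- The terms `K_{ij} J_k` and `K_{ji} J_k` cancel in the antisymmetrization.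
  rw [hS.sffT_symm hy i j]
  ring

theorem contDiffOn_momentum (j : κ) : ContDiffOn ℝ 1 (momentum b φ A g η j) W :=
  (((hS.jac.cm.of_le (by norm_num) : CM 1 _ W).transpose.mul (hS.jac.cm_comp
    (hS.metric.cm_ricci (b := b)) (by norm_num))).mul (hS.cm_nrm.of_le (by norm_num))) j ()

/-- The normal part of Yang's equations. -/
theorem yang_normal {N : κ → κ → F → ℝ}
    (hN : toMat N y = (A y).transpose * toMat (ricci b g) (φ y) * A y) (hy : y ∈ W)
    (i j : κ) :
    ((A y).transpose * pullConn φ A (fun c x => toMat (cov2 b g (ricci b g) c) x) i y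
        * nrm φ g η y) j ()
      - ((A y).transpose * pullConn φ A (fun c x => toMat (cov2 b g (ricci b g) c) x) j y
        * nrm φ g η y) i ()
      = pd b' i (momentum b φ A g η j) y - pd b' j (momentum b φ A g η i) y
        - (∑ d, mixed g' (sffT b b' φ A g η) d i y * N j d y
          - ∑ d, mixed g' (sffT b b' φ A g η) d j y * N i d y) := by
  have hT := hS.metric.cm_ricci (b := b)
  have hT' : CM 1 (fun z => toMat (ricci b g) (φ z)) W := hS.jac.cm_comp hT (by norm_num)
  have hA1 : CM 1 A W := hS.jac.cm.of_le (by norm_num)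
  -- Product rule for `R(∂_j, n)`: its derivative minus `R(∇_i ∂_j, n)` minus `R(∂_j, ∇_i n)`, the
  -- last one rewritten by the Weingarten equation.
  have h1 : ∀ i, (A y).transpose * pullConn φ A (fun c x => toMat (cov2 b g (ricci b g) c) x) i y
        * nrm φ g η y =
      mpd b' i (fun z => (A z).transpose * toMat (ricci b g) (φ z) * nrm φ g η z) y
      - (mpd b' i A y + pullConn φ A (conn b g) i y * A y).transpose
        * (toMat (ricci b g) (φ y) * nrm φ g η y)
      - toMat N y * ((toMat g' y)⁻¹ * (sff b b' φ A g η i y).transpose) := by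
    intro i
    rw [mpd_mul (hA1.transpose.mul hT') hS.cm_nrm hS.jac.isOpen hy,
      mpd_mul hA1.transpose hT' hS.jac.isOpen hy, mpd_transpose,
      hS.jac.pullConn_cov2 hT hS.metric.isOpen hy, hN, Matrix.mul_assoc _ (A y), ← hS.deriv_nrm hy]
    simp only [Matrix.transpose_mul, Matrix.transpose_add, Matrix.add_mul,
      Matrix.mul_add, Matrix.sub_mul, Matrix.mul_sub, Matrix.mul_assoc]
    abel
  -- The term `R(∇_i ∂_j, n)` is symmetric in `i, j` and drops out of the difference.
  have h2 : ((mpd b' i A y + pullConn φ A (conn b g) i y * A y).transpose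
        * (toMat (ricci b g) (φ y) * nrm φ g η y)) j () =
      ((mpd b' j A y + pullConn φ A (conn b g) j y * A y).transpose
        * (toMat (ricci b g) (φ y) * nrm φ g η y)) i () := by
    rw [Matrix.mul_apply, Matrix.mul_apply]
    refine Finset.sum_congr rfl fun a _ => ?_
    rw [Matrix.transpose_apply, Matrix.transpose_apply, hS.jac.symm_mpd_add_conn hS.metric hy]
  have h3 : ∀ i j, (toMat N y * ((toMat g' y)⁻¹ * (sff b b' φ A g η i y).transpose)) j () =
      ∑ d, mixed g' (sffT b b' φ A g η) d i y * N j d y := by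
    intro i j
    rw [Matrix.mul_apply]
    refine Finset.sum_congr rfl fun d _ => ?_
    rw [Matrix.mul_apply, mixed, mul_comm]
    refine congrArg₂ _ (Finset.sum_congr rfl fun e _ => ?_) rfl
    rw [hS.sffT_symm hy e i]
    rfl
  rw [h1, h1]
  simp only [Matrix.sub_apply]
  rw [h2, h3, h3]
  simp only [mpd, Matrix.of_apply]
  change pd b' i (momentum b φ A g η j) y - _ - _ - (pd b' j (momentum b φ A g η i) y - _ - _) = _
  ring

end IsHypersurfaceOn

end Constraints

end Coord

/-! ### Replacing a tensor by one that agrees with it on an open set. -/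

namespace Coord

section Congr

variable {κ F : Type*} [Fintype κ] [DecidableEq κ] {g T S : κ → κ → F → ℝ} {y : F}

theorem trace_congr (h : ∀ i j, T i j y = S i j y) : trace g T y = trace g S y := by
  simp only [trace, h]

theorem normSq_congr (h : ∀ i j, T i j y = S i j y) : normSq g T y = normSq g S y := by
  simp only [normSq, h]

theorem mixed_congr (h : ∀ i j, T i j y = S i j y) (i j : κ) :
    mixed g T i j y = mixed g S i j y := by
  simp only [mixed, h]

variable [NormedAddCommGroup F] [NormedSpace ℝ F] {b : κ → F} {W : Set F}

theorem cov2_congr (hW : IsOpen W) (h : ∀ z ∈ W, ∀ i j, T i j z = S i j z) (hy : y ∈ W)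
    (i j k : κ) : cov2 b g T i j k y = cov2 b g S i j k y := by
  simp only [cov2, h y hy]
  rw [pd_congr hW hy fun z hz => h z hz j k]

theorem div2_congr (hW : IsOpen W) (h : ∀ z ∈ W, ∀ i j, T i j z = S i j z) (hy : y ∈ W)
    (i : κ) : div2 b g T i y = div2 b g S i y := by
  simp only [div2, cov2_congr hW h hy]

end Congr

end Coord

/-! ### The initial slice in coordinates as a hypersurface. -/

namespace Slice

open Coord

variable {W : Set E3} {G : Idx → Idx → E4 → ℝ} {η : Idx → E4 → ℝ} {y : E3}

/-- The inclusion of the initial slice in coordinates. -/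
def incl (y : E3) : E4 := (y, 0)

/-- The Jacobian matrix of the inclusion of the initial slice. -/
def inclMat (_ : E3) : Matrix Idx (Fin 3) ℝ := Matrix.of fun a i => if a = .inl i then 1 else 0

/-- The row of components of a covector field along the initial slice. -/
def rowAt (η : Idx → E4 → ℝ) (y : E3) : Matrix Unit Idx ℝ := Matrix.of fun _ a => η a (y, 0)

theorem isJacobianOn_incl (hW : IsOpen W) :
    IsJacobianOn b4 b3 incl inclMat W (W ×ˢ univ) where
  isOpen := hW
  mapsTo y hy := ⟨hy, mem_univ _⟩
  contDiffOn := (contDiff_prodMk_left (0 : ℝ)).contDiffOn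
  cm _ _ := contDiffOn_const
  fderiv_apply y hy i := by
    have h : HasFDerivAt incl (ContinuousLinearMap.inl ℝ E3 ℝ) y :=
      hasFDerivAt_prodMk_left y (0 : ℝ)
    rw [h.fderiv]
    simp [inclMat, b4]
  symm y hy i j a := by
    have h : ∀ i, mpd b3 i inclMat y = 0 := fun i => by
      ext k l
      exact pd_const _ i
    rw [h, h]
    rfl

theorem transpose_inclMat_mul {κ : Type*} (M : Matrix Idx κ ℝ) (j : Fin 3) (k : κ) :
    ((inclMat y).transpose * M) j k = M (.inl j) k := by
  simp [Matrix.mul_apply, inclMat]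

theorem mul_inclMat {κ : Type*} (M : Matrix κ Idx ℝ) (j : κ) (k : Fin 3) :
    (M * inclMat y) j k = M j (.inl k) := by
  simp [Matrix.mul_apply, inclMat]

theorem pullConn_incl {ι₁ ι₂ : Type*} (Γ : Idx → E4 → Matrix ι₁ ι₂ ℝ) (i : Fin 3) :
    pullConn incl inclMat Γ i y = Γ (.inl i) (y, 0) := by
  simp [pullConn, inclMat, incl]

theorem toMat_pull (T : Idx → Idx → E4 → ℝ) :
    toMat (pull T) y = (inclMat y).transpose * toMat T (incl y) * inclMat y := by
  ext i j
  rw [mul_inclMat, transpose_inclMat_mul]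
  rfl

/-- A Lorentz metric on `W × ℝ` with a unit conormal field of the slices makes the initial slice a
hypersurface. -/
theorem isHypersurfaceOn_incl (hW : IsOpen W) (hG : IsMetricOn G (W ×ˢ univ))
    (hη : ∀ a, ContDiffOn ℝ 3 (η a) (W ×ˢ univ)) (hn : ∀ y ∈ W, ∀ i, η (.inl i) (y, 0) = 0)
    (hu : ∀ y ∈ W, ∑ a, ∑ c, Coord.inv G a c (y, 0) * η a (y, 0) * η c (y, 0) = -1) :
    IsHypersurfaceOn b4 b3 incl inclMat W (W ×ˢ univ) G (pull G) (rowAt η) := by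
  have hJ := isJacobianOn_incl hW
  have hnormal : ∀ y ∈ W, rowAt η y * inclMat y = 0 := by
    intro y hy
    ext u i
    rw [mul_inclMat]
    exact hn y hy i
  have hunit : ∀ y ∈ W, rowAt η y * nrm incl G (rowAt η) y = -1 := by
    intro y hy
    ext u v
    rw [Subsingleton.elim v u, Matrix.neg_apply, Matrix.one_apply_eq, ← hu y hy]
    simp only [nrm, Matrix.mul_apply, Finset.mul_sum]
    refine Finset.sum_congr rfl fun a _ => Finset.sum_congr rfl fun c _ => ?_
    simp only [rowAt, Coord.inv, toMat, incl, Matrix.of_apply, Matrix.transpose_apply]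
    ring
  -- `Q` is the candidate for `A g'⁻¹ Aᵀ`, defined before `g'` is known to be invertible.
  set Q : E3 → Matrix Idx Idx ℝ := fun y => (toMat G (incl y))⁻¹
    + nrm incl G (rowAt η) y * (nrm incl G (rowAt η) y).transpose with hQ
  have hQt : ∀ y, (Q y).transpose = Q y := by
    intro y
    simp only [hQ, Matrix.transpose_add, Matrix.transpose_mul, Matrix.transpose_transpose,
      hG.transpose_inv]
  have hη0 : ∀ y ∈ W, ∀ {κ : Type} (M : Matrix Idx κ ℝ) (k : κ),
      (rowAt η y * M) () k = η (.inr ()) (y, 0) * M (.inr ()) k := by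
    intro y hy κ M k
    simp [Matrix.mul_apply, rowAt, hn y hy]
  -- Along the slice only the time component of `η` can be nonzero, and it is nonzero because `η n =
  -- -1`; so `η Q = 0` kills the time row of `Q`.
  have hQ0 : ∀ y ∈ W, ∀ a, Q y (.inr ()) a = 0 := by
    intro y hy a
    have h1 : rowAt η y * Q y = 0 := by
      simp only [hQ]
      rw [Matrix.mul_add, ← Matrix.mul_assoc, hunit y hy, nrm, Matrix.transpose_mul,
        Matrix.transpose_transpose, hG.transpose_inv]
      simp
    have h2 := congrFun (congrFun h1 ()) a
    rw [hη0 y hy] at h2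
    refine (mul_eq_zero.mp h2).resolve_left fun h0 => ?_
    have h3 := congrFun (congrFun (hunit y hy) ()) ()
    rw [hη0 y hy, h0] at h3
    simp at h3
  have hQl : ∀ y ∈ W, inclMat y * ((inclMat y).transpose * Q y) = Q y := by
    intro y hy
    ext a c
    rw [Matrix.mul_apply]
    simp only [transpose_inclMat_mul]
    rcases a with a | a
    · simp [inclMat]
    · simp [inclMat, hQ0 y hy c]
  have hQr : ∀ y ∈ W, Q y * inclMat y * (inclMat y).transpose = Q y := by
    intro y hy
    have h := congrArg Matrix.transpose (hQl y hy)
    simpa only [Matrix.transpose_mul, Matrix.transpose_transpose, hQt] using h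
  have hAA : ∀ y, (inclMat y).transpose * inclMat y = 1 := by
    intro y
    ext i j
    rw [transpose_inclMat_mul]
    simp [inclMat, Matrix.one_apply]
  -- The spatial block of `Q` is a right inverse of the induced metric. This yields both its
  -- nondegeneracy and the projection formula.
  have hinv : ∀ y ∈ W, toMat (pull G) y * ((inclMat y).transpose * Q y * inclMat y) = 1 := by
    intro y hy
    have h1 : toMat G (incl y) * Q y =
        1 + (rowAt η y).transpose * (nrm incl G (rowAt η) y).transpose := by
      simp only [hQ]
      rw [Matrix.mul_add, Matrix.mul_nonsing_inv _ (hG.isUnit ⟨hy, mem_univ _⟩), ← Matrix.mul_assoc]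
      congr 2
      rw [nrm, Matrix.mul_nonsing_inv_cancel_left _ _ (hG.isUnit ⟨hy, mem_univ _⟩)]
    have h2 : (inclMat y).transpose * (rowAt η y).transpose = 0 := by
      rw [← Matrix.transpose_mul, hnormal y hy, Matrix.transpose_zero]
    rw [toMat_pull, Matrix.mul_assoc, ← Matrix.mul_assoc (inclMat y) _ (inclMat y), hQl y hy,
      Matrix.mul_assoc, ← Matrix.mul_assoc (toMat G _), h1, Matrix.add_mul, Matrix.mul_add,
      Matrix.one_mul, hAA, ← Matrix.mul_assoc, ← Matrix.mul_assoc, h2]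
    simp
  exact
    { jac := hJ
      metric := hG
      metric' :=
        { isOpen := hW
          symm := fun i j => by
            funext y
            rw [pull, hG.symm]
            rfl
          contDiffOn := fun i j => hJ.cm_comp hG.cm_toMat le_rfl (.inl i) (.inl j)
          det_ne_zero := fun y hy =>
            (Matrix.isUnit_det_of_right_inverse (hinv y hy)).ne_zero }
      toMat_eq := fun y _ => toMat_pull G
      cm := fun _ a => (hη a).comp hJ.contDiffOn hJ.mapsTo
      normal := hnormal
      unit := hunit
      proj := fun y hy => by
        rw [Matrix.inv_eq_right_inv (hinv y hy), Matrix.mul_assoc (Matrix.transpose _),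
          ← Matrix.mul_assoc, Matrix.mul_assoc _ _ (Matrix.transpose _), Matrix.mul_assoc,
          hQr y hy, hQl y hy] }

end Slice

/-! ### The three constraints in a single chart. -/

namespace Slice

open Coord

variable {V : Type*} [TopologicalSpace V] [ChartedSpace E3 V] {g : BilinField V} {n : VecField V}
  {e : OpenPartialHomeomorph V E3} {y : E3}

/-- The data of a chart on the initial slice. -/
structure IsSliceChart (g : BilinField V) (n : VecField V) (e : OpenPartialHomeomorph V E3) :
    Prop where
  hyp : IsHypersurfaceOn b4 b3 incl inclMat e.target (e.target ×ˢ univ) (comp g e) (metric3 g e)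
    (rowAt (coVecComp g n e))
  conormal : ∀ a, ContDiffOn ℝ 3 (coVecComp g n e a) (e.target ×ˢ univ)

namespace IsSliceChart

variable (h : IsSliceChart g n e)
include h

theorem pd_incl {f : E4 → ℝ} {m : WithTop ℕ∞} (hf : ContDiffOn ℝ m f (e.target ×ˢ univ))
    (hm : m ≠ 0) (hy : y ∈ e.target) (i : Fin 3) :
    pd b3 i (fun z => f (z, 0)) y = pd b4 (.inl i) f (y, 0) := by
  refine (h.hyp.jac.pd_comp hf h.hyp.metric.isOpen hy hm i).trans ?_
  simp [inclMat, incl]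

/-- Only tangential derivatives of `η` enter, and these commute with restriction to the slice. -/
theorem sffT_eq (hy : y ∈ e.target) (i j : Fin 3) :
    secondForm g n e i j y = sffT b4 b3 incl inclMat (comp g e) (rowAt (coVecComp g n e)) i j y := by
  rw [sffT, sff, mul_inclMat, Matrix.sub_apply, pullConn_incl]
  have h1 : mpd b3 i (rowAt (coVecComp g n e)) y () (.inl j) =
      pd b4 (.inl i) (coVecComp g n e (.inl j)) (y, 0) :=
    h.pd_incl (h.conormal _) (by norm_num) hy i
  rw [h1, Matrix.mul_apply, secondForm, pull, cov1]
  exact congrArg₂ _ rfl (Finset.sum_congr rfl fun a _ => mul_comm _ _)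

theorem codazzi (hy : y ∈ e.target) (i : Fin 3) :
    div2 b3 (metric3 g e) (secondForm g n e) i y - pd b3 i (meanCurv g n e) y =
      momentum b4 incl inclMat (comp g e) (rowAt (coVecComp g n e)) i y := by
  rw [← h.hyp.codazzi_contracted hy]
  exact congrArg₂ _ (div2_congr h.hyp.jac.isOpen (fun z hz => h.sffT_eq hz) hy i)
    (pd_congr h.hyp.jac.isOpen hy (fun z hz => trace_congr (h.sffT_eq hz)) i)

/-- Class `C²` is what makes the curl of the gradient of the mean curvature vanish in `yang_normal`.
-/
theorem contDiffOn_meanCurv : ContDiffOn ℝ 2 (meanCurv g n e) e.target := by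
  have hM : CM 2 (fun z => toMat (sffT b4 b3 incl inclMat (comp g e) (rowAt (coVecComp g n e))) z
      * (toMat (metric3 g e) z)⁻¹) e.target :=
    h.hyp.cm_sffT.mul (h.hyp.metric'.cm_inv.of_le (by norm_num))
  refine ContDiffOn.congr (f := fun z => ∑ i, (toMat (sffT b4 b3 incl inclMat (comp g e)
    (rowAt (coVecComp g n e))) z * (toMat (metric3 g e) z)⁻¹) i i)
    (ContDiffOn.sum fun i _ => hM i i) fun z hz => ?_
  rw [meanCurv, trace_congr (h.sffT_eq hz), h.hyp.metric'.trace_eq]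
  rfl

theorem yang_tangential (hy : y ∈ e.target) (i j k : Fin 3) :
    yang b4 (comp g e) (.inl i) (.inl j) (.inl k) (y, 0) =
      cov2 b3 (metric3 g e) (ricciPull g e) i j k y - cov2 b3 (metric3 g e) (ricciPull g e) j i k y
        - (secondForm g n e i k y * (div2 b3 (metric3 g e) (secondForm g n e) j y
            - pd b3 j (meanCurv g n e) y)
          - secondForm g n e j k y * (div2 b3 (metric3 g e) (secondForm g n e) i y
            - pd b3 i (meanCurv g n e) y)) := by
  have h1 := h.hyp.yang_tangential (N := ricciPull g e) (fun z _ => toMat_pull _) hy i j k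
  simp only [mul_inclMat, transpose_inclMat_mul, pullConn_incl] at h1
  rw [h.codazzi hy, h.codazzi hy, h.sffT_eq hy, h.sffT_eq hy, ← h1]
  rfl

/-- The component `Y_{cba}` is twice the difference of the two sides of (1), once the symmetry of
`K` has reordered its indices. -/
theorem yangTangential_iff (hy : y ∈ e.target) :
    YangTangential g e y ↔ Constraint1 g n e y := by
  have hs : ∀ i j, secondForm g n e i j y = secondForm g n e j i y := fun i j => by
    rw [h.sffT_eq hy, h.sffT_eq hy, h.hyp.sffT_symm hy]
  constructor
  · intro hY a b c
    have h1 := h.yang_tangential hy c b a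
    rw [hY c b a, hs c a, hs b a] at h1
    linear_combination (-1 / 2) * h1
  · intro hC i j k
    have h1 := hC k j i
    beta_reduce at h1
    rw [h.yang_tangential hy, hs i k, hs j k]
    linear_combination 2 * h1

/-- Codazzi replaces `J` by the divergence of `K` minus a gradient. The gradient has no curl, and
the Christoffel terms of the antisymmetrized covariant derivative cancel, so the curl of `J` is that
of the divergence. -/
theorem yang_normal (hy : y ∈ e.target) (i j : Fin 3) :
    ∑ c, ∑ d, Coord.inv (comp g e) c d (y, 0) * coVecComp g n e d (y, 0) *
      yang b4 (comp g e) (.inl i) (.inl j) c (y, 0) =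
    cov1 b3 (metric3 g e) (div2 b3 (metric3 g e) (secondForm g n e)) i j y
      - cov1 b3 (metric3 g e) (div2 b3 (metric3 g e) (secondForm g n e)) j i y
      - (∑ d, mixed (metric3 g e) (secondForm g n e) d i y * ricciPull g e j d y
        - ∑ d, mixed (metric3 g e) (secondForm g n e) d j y * ricciPull g e i d y) := by
  have hW := h.hyp.jac.isOpen
  have h1 := h.hyp.yang_normal (N := ricciPull g e) (toMat_pull _) hy i j
  simp only [Matrix.mul_assoc, transpose_inclMat_mul, pullConn_incl] at h1
  have h2 : ∀ i j, pd b3 i (momentum b4 incl inclMat (comp g e) (rowAt (coVecComp g n e)) j) y =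
      pd b3 i (div2 b3 (metric3 g e) (secondForm g n e) j) y
        - pd b3 i (pd b3 j (meanCurv g n e)) y := by
    intro i j
    have hJ := h.hyp.contDiffOn_momentum (b := b4) j
    have hK : ContDiffOn ℝ 1 (pd b3 j (meanCurv g n e)) e.target :=
      contDiffOn_pd h.contDiffOn_meanCurv hW (by norm_num [one_add_one_eq_two]) j
    -- Reading Codazzi as divergence equals `J` plus gradient, only the two fields already known to
    -- be `C¹` have to be differentiated.
    rw [eq_sub_iff_add_eq, ← pd_add ((hJ.contDiffAt (hW.mem_nhds hy)).differentiableAt (by norm_num))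
      ((hK.contDiffAt (hW.mem_nhds hy)).differentiableAt (by norm_num))]
    refine pd_congr hW hy (fun z hz => ?_) i
    rw [← h.codazzi hz]
    ring
  have h3 : ∑ k, christoffel b3 (metric3 g e) k i j y * div2 b3 (metric3 g e) (secondForm g n e) k y
      = ∑ k, christoffel b3 (metric3 g e) k j i y *
        div2 b3 (metric3 g e) (secondForm g n e) k y :=
    Finset.sum_congr rfl fun k _ => by rw [h.hyp.metric'.christoffel_symm]
  have h4 : ∀ d i, mixed (metric3 g e) (secondForm g n e) d i y =
      mixed (metric3 g e) (sffT b4 b3 incl inclMat (comp g e) (rowAt (coVecComp g n e))) d i y :=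
    mixed_congr (h.sffT_eq hy)
  rw [h2, h2, pd_comm h.contDiffOn_meanCurv hW hy i j] at h1
  simp only [cov1, h3, h4]
  rw [sub_sub_sub_cancel_right] at h1 ⊢
  rw [← h1, Matrix.mul_apply, Matrix.mul_apply, ← Finset.sum_sub_distrib]
  refine Finset.sum_congr rfl fun c _ => ?_
  rw [← Finset.sum_mul, ← sub_mul, mul_comm]
  rfl

theorem yangNormal_iff (hy : y ∈ e.target) :
    YangNormal g n e y ↔ Constraint2 g n e y := by
  constructor
  · intro hY a b
    have h1 := h.yang_normal hy a b
    rw [hY a b] at h1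
    linear_combination (1 / 2) * h1
  · intro hC i j
    have h1 := hC i j
    beta_reduce at h1
    rw [h.yang_normal hy]
    linear_combination (-2) * h1

theorem scalar_constraint (hy : y ∈ e.target) :
    scalar b3 (metric3 g e) y + meanCurv g n e y ^ 2
      - normSq (metric3 g e) (secondForm g n e) y
      - 2 * trace (metric3 g e) (ricciPull g e) y = -scalar b4 (comp g e) (y, 0) := by
  rw [meanCurv, trace_congr (h.sffT_eq hy), normSq_congr (h.sffT_eq hy)]
  exact h.hyp.scalar_constraint (toMat_pull _) hy

theorem yang_trace (hy : y ∈ e.target) (i : Fin 3) :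
    ∑ c, ∑ d, Coord.inv (comp g e) c d (y, 0) * yang b4 (comp g e) (.inl i) c d (y, 0) =
      (1 / 2) * pd b3 i (fun z => scalar b4 (comp g e) (z, 0)) y := by
  rw [h.pd_incl h.hyp.metric.contDiffOn_scalar one_ne_zero hy]
  exact h.hyp.metric.trace_yang (h.hyp.jac.mapsTo y hy) _

theorem yangTrace_iff (hy : y ∈ e.target) :
    YangTrace g e y ↔ fderiv ℝ (fun z => scalar b4 (comp g e) (z, 0)) y = 0 := by
  constructor
  · intro hY
    refine ContinuousLinearMap.coe_injective
      ((EuclideanSpace.basisFun (Fin 3) ℝ).toBasis.ext fun i => ?_)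
    have h1 := h.yang_trace hy i
    rw [hY i] at h1
    simpa [pd, b3] using h1.symm
  · intro hD i
    rw [h.yang_trace hy, pd, hD]
    simp

end IsSliceChart

end Slice

/-! ### From tensor fields on the manifold to chart components. -/

namespace Slice

open Coord

variable {V : Type*} [TopologicalSpace V] [ChartedSpace E3 V] [IsManifold (𝓡 3) ∞ V]
  {g : BilinField V} {n : VecField V} {e e' : OpenPartialHomeomorph V E3} {y : E3} {z : E4}

/-- The bilinear form `g` at a point, on the coordinate space. -/
def form (g : BilinField V) (x : V × ℝ) : E4 →L[ℝ] E4 →L[ℝ] ℝ := g x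

/-- The differential of the inverse of the chart `e × id`. -/
def dparam (e : OpenPartialHomeomorph V E3) (z : E4) : E4 →L[ℝ] E4 :=
  mfderiv 𝓘(ℝ, E4) I4 (param e) z

theorem mdifferentiableAt_param (he : e ∈ atlas E3 V) (hz : z.1 ∈ e.target) :
    MDifferentiableAt 𝓘(ℝ, E4) I4 (param e) z := by
  have h1 : ContMDiffOn (𝓡 3) (𝓡 3) ∞ e.symm e.target :=
    contMDiffOn_symm_of_mem_maximalAtlas (IsManifold.subset_maximalAtlas he)
  have h2 : MDifferentiableAt (𝓡 3) (𝓡 3) e.symm z.1 :=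
    (h1.contMDiffAt (e.open_target.mem_nhds hz)).mdifferentiableAt (by simp)
  have h3 : MDifferentiableAt 𝓘(ℝ, E4) (𝓡 3) (Prod.fst : E4 → E3) z :=
    differentiableAt_fst.mdifferentiableAt
  have h4 : MDifferentiableAt 𝓘(ℝ, E4) 𝓘(ℝ, ℝ) (Prod.snd : E4 → ℝ) z :=
    differentiableAt_snd.mdifferentiableAt
  exact (h2.comp z h3).prodMk h4

/-- The chart `e × id`. -/
def chart4 (e : OpenPartialHomeomorph V E3) (x : V × ℝ) : E4 := (e x.1, x.2)

theorem mdifferentiableAt_chart4 (he : e ∈ atlas E3 V) {x : V × ℝ} (hx : x.1 ∈ e.source) :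
    MDifferentiableAt I4 𝓘(ℝ, E4) (chart4 e) x := by
  have h1 : ContMDiffOn (𝓡 3) (𝓡 3) ∞ e e.source :=
    contMDiffOn_of_mem_maximalAtlas (IsManifold.subset_maximalAtlas he)
  have h2 : MDifferentiableAt (𝓡 3) (𝓡 3) e x.1 :=
    (h1.contMDiffAt (e.open_source.mem_nhds hx)).mdifferentiableAt (by simp)
  have h3 : MDifferentiableAt I4 (𝓡 3) (fun x : V × ℝ => e x.1) x :=
    h2.comp x mdifferentiableAt_fst
  exact h3.prodMk_space mdifferentiableAt_snd

/-- The chart is a local left inverse of `param e`, which gives injectivity; surjectivity follows by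
equality of finite dimensions. -/
theorem dparam_bijective (he : e ∈ atlas E3 V) (hz : z.1 ∈ e.target) :
    Function.Bijective (dparam e z) := by
  have h1 := mdifferentiableAt_param he hz
  have h2 : MDifferentiableAt I4 𝓘(ℝ, E4) (chart4 e) (param e z) :=
    mdifferentiableAt_chart4 he (e.map_target hz)
  have h3 : mfderiv 𝓘(ℝ, E4) 𝓘(ℝ, E4) (chart4 e ∘ param e) z = ContinuousLinearMap.id ℝ E4 := by
    have h4 : chart4 e ∘ param e =ᶠ[nhds z] id := by
      filter_upwards [(e.open_target.preimage continuous_fst).mem_nhds hz] with w hw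
      exact Prod.ext (e.right_inv hw) rfl
    rw [h4.mfderiv_eq]
    exact mfderiv_id
  rw [mfderiv_comp z h2 h1] at h3
  have h5 : Function.Injective (dparam e z) := by
    intro u v huv
    have h6 : ∀ u : E4, (mfderiv I4 𝓘(ℝ, E4) (chart4 e) (param e z)) (dparam e z u) = u := fun u =>
      congrArg (fun L : E4 →L[ℝ] E4 => L u) h3
    rw [← h6 u, ← h6 v, huv]
  exact ⟨h5, LinearMap.surjective_of_injective (f := (dparam e z).toLinearMap) h5⟩

omit [IsManifold (𝓡 3) ∞ V] in
theorem comp_eq (a c : Idx) : comp g e a c z =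
    form g (param e z) (dparam e z (b4 a)) (dparam e z (b4 c)) := rfl

/-- The coordinates of a vector of `E4`. -/
def coord : Idx → E4 →L[ℝ] ℝ :=
  Sum.elim (fun k => (EuclideanSpace.proj k).comp (ContinuousLinearMap.fst ℝ E3 ℝ))
    (fun _ => ContinuousLinearMap.snd ℝ E3 ℝ)

theorem sum_coord (v : E4) : ∑ a, coord a v • b4 a = v := by
  have h : ∑ k, v.1 k • b3 k = v.1 := by
    have := (EuclideanSpace.basisFun (Fin 3) ℝ).sum_repr v.1
    simpa [b3] using this
  rw [Fintype.sum_sum_type]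
  refine Prod.ext ?_ ?_
  · simpa [coord, b4, Prod.fst_sum] using h
  · simp [coord, b4, Prod.snd_sum]

/-- Four orthogonal vectors with nonzero squares are independent, hence a basis; pairing `u` with
each of them shows that its coefficients vanish. -/
theorem nondegenerate_of_signature (B : E4 →L[ℝ] E4 →L[ℝ] ℝ) (v : Fin 4 → E4)
    (hv : ∀ i j, B (v i) (v j) = if i = j then (if i = 0 then -1 else 1) else 0) (u : E4)
    (hu : ∀ w, B u w = 0) : u = 0 := by
  have key : ∀ c : Fin 4 → ℝ, ∀ j, B (∑ i, c i • v i) (v j) =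
      c j * (if j = 0 then -1 else 1) := by
    intro c j
    simp [map_sum, hv]
  have hne : ∀ j : Fin 4, (if j = 0 then (-1 : ℝ) else 1) ≠ 0 := fun j => by
    split_ifs <;> norm_num
  have hli : LinearIndependent ℝ v := by
    rw [Fintype.linearIndependent_iff]
    intro c hc j
    have h1 := key c j
    rw [hc] at h1
    exact (mul_eq_zero.mp (by simpa using h1.symm)).resolve_right (hne j)
  have hcard : Fintype.card (Fin 4) = Module.finrank ℝ E4 := by simp
  have hsp := hli.span_eq_top_of_card_eq_finrank' hcard
  have hmem : u ∈ Submodule.span ℝ (Set.range v) := hsp ▸ Submodule.mem_top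
  obtain ⟨c, rfl⟩ := (Submodule.mem_span_range_iff_exists_fun ℝ).mp hmem
  refine Finset.sum_eq_zero fun i _ => ?_
  have h1 := key c i
  rw [hu] at h1
  rw [(mul_eq_zero.mp h1.symm).resolve_right (hne i), zero_smul]

theorem isMetricOn_comp (hg : IsLorentzMetric g) (he : e ∈ atlas E3 V) :
    IsMetricOn (comp g e) (e.target ×ˢ univ) where
  isOpen := e.open_target.prod isOpen_univ
  symm a c := funext fun z => hg.symm _ _ _
  contDiffOn := hg.regular e he
  det_ne_zero z hz := by
    intro hdet
    obtain ⟨c, hc, hc0⟩ := Matrix.exists_mulVec_eq_zero_iff.mpr hdet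
    have hb := dparam_bijective he hz.1
    -- A kernel vector of the component matrix gives a tangent vector orthogonal to every `w`,
    -- because the coordinate vectors span.
    have h1 : ∀ w, form g (param e z) (dparam e z (∑ a, c a • b4 a)) w = 0 := by
      intro w
      obtain ⟨v, rfl⟩ := hb.2 w
      rw [← sum_coord v]
      simp only [map_sum, map_smul, smul_eq_mul,
        sum_apply, smul_apply]
      refine Finset.sum_eq_zero fun a _ => ?_
      have h2 := congrFun hc0 a
      have h3 : ∑ d, c d * form g (param e z) (dparam e z (b4 d)) (dparam e z (b4 a)) = 0 := by
        rw [Matrix.mulVec, dotProduct] at h2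
        rw [← show (0 : Idx → ℝ) a = 0 from rfl, ← h2]
        refine Finset.sum_congr rfl fun d _ => ?_
        rw [mul_comm, ← comp_eq]
        exact congrArg (· * c d) (hg.symm _ _ _)
      rw [h3, mul_zero]
    obtain ⟨v, hv⟩ := hg.signature (param e z)
    have h4 := hb.1 ((nondegenerate_of_signature (form g (param e z)) v hv _ h1).trans
      (map_zero _).symm)
    refine hc (funext fun a => ?_)
    have h5 := congrArg (coord a) h4
    have h6 : ∀ d, coord a (b4 d) = if a = d then 1 else 0 := by
      rcases a with a | a <;> rintro (d | d) <;> simp [coord, b4, b3]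
    change c a = 0
    simpa only [map_sum, map_smul, smul_eq_mul, h6, mul_ite, mul_one, mul_zero, Finset.sum_ite_eq,
      Finset.mem_univ, if_true, map_zero] using h5

theorem isSliceChart (hg : IsLorentzMetric g) (hn : IsUnitNormal g n) (he : e ∈ atlas E3 V) :
    IsSliceChart g n e where
  conormal := hn.regular e he
  hyp := by
    have hM := isMetricOn_comp hg he
    refine isHypersurfaceOn_incl e.open_target hM (hn.regular e he) (fun y hy i => ?_)
      (fun y hy => ?_)
    -- Spatial coordinate vectors are tangent to `V₀`: both sides are derivatives of the same map `y
    -- ↦ (e.symm y, 0)`, factored in two ways.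
    · have h1 : dparam e (y, 0) (b3 i, 0) =
          sliceIncl (e.symm y) 0 (mfderiv (𝓡 3) (𝓡 3) e.symm y (b3 i)) := by
        have hs : MDifferentiableAt (𝓡 3) (𝓡 3) e.symm y :=
          ((contMDiffOn_symm_of_mem_maximalAtlas (n := ∞) (IsManifold.subset_maximalAtlas he)).contMDiffAt
            (e.open_target.mem_nhds hy)).mdifferentiableAt (by simp)
        have hi : MDifferentiableAt (𝓡 3) I4 (fun q : V => (q, (0 : ℝ))) (e.symm y) :=
          mdifferentiableAt_id.prodMk mdifferentiableAt_const
        have hj : HasFDerivAt (fun y : E3 => (y, (0 : ℝ))) (ContinuousLinearMap.inl ℝ E3 ℝ) y :=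
          hasFDerivAt_prodMk_left y (0 : ℝ)
        have hj' : MDifferentiableAt (𝓡 3) 𝓘(ℝ, E4) (fun y : E3 => (y, (0 : ℝ))) y :=
          hj.differentiableAt.mdifferentiableAt
        have h2 : mfderiv (𝓡 3) I4 ((fun q : V => (q, (0 : ℝ))) ∘ e.symm) y = _ :=
          mfderiv_comp y hi hs
        have h3 : mfderiv (𝓡 3) I4 (param e ∘ fun y : E3 => (y, (0 : ℝ))) y = _ :=
          mfderiv_comp y (mdifferentiableAt_param (z := (y, 0)) he hy) hj'
        have h4 : mfderiv (𝓡 3) 𝓘(ℝ, E4) (fun y : E3 => (y, (0 : ℝ))) y =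
            ContinuousLinearMap.inl ℝ E3 ℝ := by
          rw [mfderiv_eq_fderiv]
          exact hj.fderiv
        have h5 : mfderiv (𝓡 3) I4 ((fun q : V => (q, (0 : ℝ))) ∘ e.symm) y =
          mfderiv (𝓡 3) I4 (param e ∘ fun y : E3 => (y, (0 : ℝ))) y := rfl
        rw [h2, h3, h4] at h5
        exact (congrArg (fun L : E3 →L[ℝ] E4 => L (b3 i)) h5).symm
      have h2 := hn.normal (e.symm y) 0 (mfderiv (𝓡 3) (𝓡 3) e.symm y (b3 i))
      rw [← h1] at h2
      exact h2
    · have hz : ((y, 0) : E4) ∈ e.target ×ˢ (univ : Set ℝ) := ⟨hy, mem_univ _⟩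
      obtain ⟨v, hv⟩ := (dparam_bijective he (z := (y, 0)) hy).2 (n (param e (y, 0)))
      have hη : ∀ a, coVecComp g n e a (y, 0) = ∑ d, comp g e a d (y, 0) * coord d v := by
        intro a
        have h1 : coVecComp g n e a (y, 0) =
            form g (param e (y, 0)) (dparam e (y, 0) v) (dparam e (y, 0) (b4 a)) := by
          rw [hv]; rfl
        rw [h1]
        conv_lhs => rw [← sum_coord v]
        simp only [map_sum, map_smul, smul_eq_mul, sum_apply,
          smul_apply]
        refine Finset.sum_congr rfl fun d _ => ?_
        rw [hM.symm a d, mul_comm, comp_eq]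
      have hu : ∑ a, coord a v * coVecComp g n e a (y, 0) = -1 := by
        rw [← hn.unit (param e (y, 0))]
        have h1 : g (param e (y, 0)) (n (param e (y, 0))) (n (param e (y, 0))) =
            form g (param e (y, 0)) (n (param e (y, 0))) (dparam e (y, 0) (∑ a, coord a v • b4 a)) := by
          rw [sum_coord, hv]; rfl
        rw [h1]
        simp only [map_sum, map_smul, smul_eq_mul]
        rfl
      -- Raising the index of `η` recovers the coordinates `v` of `n`, so the norm of `η` under the
      -- inverse metric is `g(n, n) = -1`.
      have hinv : ∀ a, ∑ c, Coord.inv (comp g e) a c (y, 0) * coVecComp g n e c (y, 0) =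
          coord a v := by
        intro a
        have h1 : (fun c => coVecComp g n e c (y, 0)) =
            (toMat (comp g e) (y, 0)).mulVec (fun d => coord d v) := funext hη
        have h2 : ∑ c, Coord.inv (comp g e) a c (y, 0) * coVecComp g n e c (y, 0) =
            ((toMat (comp g e) (y, 0))⁻¹.mulVec fun c => coVecComp g n e c (y, 0)) a := rfl
        rw [h2, h1, Matrix.mulVec_mulVec, Matrix.nonsing_inv_mul _ (hM.isUnit hz),
          Matrix.one_mulVec]
      rw [← hu]
      refine Finset.sum_congr rfl fun a _ => ?_
      rw [← hinv a, Finset.sum_mul]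
      exact Finset.sum_congr rfl fun c _ => by ring

end Slice

/-! ### Chart independence of the scalar curvature and its constancy on `V₀`. -/

namespace Slice

open Coord

variable {V : Type*} [TopologicalSpace V] [ChartedSpace E3 V] [IsManifold (𝓡 3) ∞ V]
  {g : BilinField V} {n : VecField V} {e e' : OpenPartialHomeomorph V E3} {y : E3} {z : E4}

/-- The change of coordinates from `e' × id` to `e × id`. -/
def transition (e e' : OpenPartialHomeomorph V E3) (z : E4) : E4 := (e (e'.symm z.1), z.2)

/-- The Jacobian matrix of the change of coordinates. -/
def transitionMat (e e' : OpenPartialHomeomorph V E3) (z : E4) : Matrix Idx Idx ℝ :=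
  Matrix.of fun a i => pd b4 i (fun w => coord a (transition e e' w)) z

theorem contDiffOn_transition (he : e ∈ atlas E3 V) (he' : e' ∈ atlas E3 V) :
    ContDiffOn ℝ 3 (transition e e') ((e'.symm ≫ₕ e).source ×ˢ univ) := by
  have h1 : ContMDiffOn (𝓡 3) (𝓡 3) ∞ (e ∘ e'.symm) (e'.symm ≫ₕ e).source :=
    (contMDiffOn_of_mem_maximalAtlas (IsManifold.subset_maximalAtlas he)).comp
      ((contMDiffOn_symm_of_mem_maximalAtlas (IsManifold.subset_maximalAtlas he')).mono
        fun w hw => hw.1) fun w hw => hw.2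
  have h2 : ContDiffOn ℝ 3 (e ∘ e'.symm) (e'.symm ≫ₕ e).source :=
    h1.contDiffOn.of_le (WithTop.coe_le_coe.mpr le_top : ((3 : ℕ∞) : WithTop ℕ∞) ≤ ∞)
  exact (h2.comp contDiffOn_fst fun w hw => hw.1).prodMk contDiffOn_snd

theorem isJacobianOn_transition (he : e ∈ atlas E3 V) (he' : e' ∈ atlas E3 V) :
    IsJacobianOn b4 b4 (transition e e') (transitionMat e e')
      ((e'.symm ≫ₕ e).source ×ˢ univ) (e.target ×ˢ univ) := by
  have hφ := contDiffOn_transition he he'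
  have hW : IsOpen ((e'.symm ≫ₕ e).source ×ˢ (univ : Set ℝ)) :=
    (e'.symm ≫ₕ e).open_source.prod isOpen_univ
  have hc : ∀ a, ContDiffOn ℝ 3 (fun w => coord a (transition e e' w))
      ((e'.symm ≫ₕ e).source ×ˢ univ) := fun a => (coord a).contDiff.comp_contDiffOn hφ
  exact
    { isOpen := hW
      mapsTo := fun z hz => ⟨e.map_source hz.1.2, mem_univ _⟩
      contDiffOn := hφ
      cm := fun a i => contDiffOn_pd (hc a) hW (by norm_num [two_add_one_eq_three]) i
      fderiv_apply := fun z hz i => by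
        have hd : DifferentiableAt ℝ (transition e e') z :=
          (hφ.contDiffAt (hW.mem_nhds hz)).differentiableAt (by norm_num)
        have h1 : ∀ a, transitionMat e e' z a i = coord a (fderiv ℝ (transition e e') z (b4 i)) := by
          intro a
          have h2 := fderiv_comp z ((coord a).differentiableAt) hd
          rw [ContinuousLinearMap.fderiv] at h2
          exact congrArg (fun L : E4 →L[ℝ] ℝ => L (b4 i)) h2
        simp only [h1]
        exact (sum_coord _).symm
      symm := fun z hz i j a => pd_comm ((hc a).of_le (by norm_num)) hW hz i j }

omit [ChartedSpace E3 V] [IsManifold (𝓡 3) ∞ V] in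
theorem param_transition (hz : z ∈ (e'.symm ≫ₕ e).source ×ˢ (univ : Set ℝ)) :
    param e (transition e e' z) = param e' z :=
  Prod.ext (e.left_inv hz.1.2) rfl

theorem dparam_transition (he : e ∈ atlas E3 V) (he' : e' ∈ atlas E3 V)
    (hz : z ∈ (e'.symm ≫ₕ e).source ×ˢ (univ : Set ℝ)) (v : E4) :
    dparam e' z v = dparam e (transition e e' z) (fderiv ℝ (transition e e') z v) := by
  have hW : IsOpen ((e'.symm ≫ₕ e).source ×ˢ (univ : Set ℝ)) :=
    (e'.symm ≫ₕ e).open_source.prod isOpen_univ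
  have hd : DifferentiableAt ℝ (transition e e') z :=
    ((contDiffOn_transition he he').contDiffAt (hW.mem_nhds hz)).differentiableAt (by norm_num)
  have h1 : param e ∘ transition e e' =ᶠ[nhds z] param e' := by
    filter_upwards [hW.mem_nhds hz] with w hw
    exact param_transition hw
  have h2 : mfderiv 𝓘(ℝ, E4) I4 (param e ∘ transition e e') z =
      (dparam e (transition e e' z)).comp (fderiv ℝ (transition e e') z) := by
    rw [mfderiv_comp z (mdifferentiableAt_param (z := transition e e' z) he
      (e.map_source hz.1.2)) hd.mdifferentiableAt, mfderiv_eq_fderiv]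
    rfl
  have h3 : dparam e' z = mfderiv 𝓘(ℝ, E4) I4 (param e ∘ transition e e') z :=
    h1.mfderiv_eq.symm
  exact congrArg (fun L : E4 →L[ℝ] E4 => L v) (h3.trans h2)

theorem toMat_comp_transition (he : e ∈ atlas E3 V) (he' : e' ∈ atlas E3 V)
    (hz : z ∈ (e'.symm ≫ₕ e).source ×ˢ (univ : Set ℝ)) :
    toMat (comp g e') z = (transitionMat e e' z).transpose *
      toMat (comp g e) (transition e e' z) * transitionMat e e' z := by
  have hJ := (isJacobianOn_transition he he').fderiv_apply z hz
  ext i j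
  have h1 : toMat (comp g e') z i j = form g (param e (transition e e' z))
      (dparam e' z (b4 i)) (dparam e' z (b4 j)) := by
    rw [param_transition hz]
    rfl
  rw [h1, dparam_transition he he' hz, dparam_transition he he' hz, hJ, hJ, Matrix.mul_assoc,
    Matrix.mul_apply]
  simp only [map_sum, map_smul, smul_eq_mul, sum_apply, smul_apply, Matrix.mul_apply,
    Matrix.transpose_apply, Finset.mul_sum]
  rw [Finset.sum_comm]
  refine Finset.sum_congr rfl fun a _ => Finset.sum_congr rfl fun c _ => ?_
  rw [← comp_eq]
  simp only [toMat, Matrix.of_apply]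
  ring

/-- The scalar curvature of spacetime does not depend on the chart. -/
theorem scalar_transition (hg : IsLorentzMetric g) (he : e ∈ atlas E3 V) (he' : e' ∈ atlas E3 V)
    (hz : z ∈ (e'.symm ≫ₕ e).source ×ˢ (univ : Set ℝ)) :
    scalar b4 (comp g e') z = scalar b4 (comp g e) (transition e e' z) := by
  have hM := isMetricOn_comp hg he'
  refine (isJacobianOn_transition he he').scalar_comp (isMetricOn_comp hg he)
    ⟨(e'.symm ≫ₕ e).open_source.prod isOpen_univ, hM.symm, fun a c => (hM.contDiffOn a c).mono ?_,
      fun w hw => hM.det_ne_zero w ⟨hw.1.1, mem_univ _⟩⟩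
    (fun w hw => toMat_comp_transition he he' hw) hz
  exact fun w hw => ⟨hw.1.1, mem_univ _⟩

/-- The scalar curvature of spacetime at a point of the initial slice. -/
def scalarAt (g : BilinField V) (p : V) : ℝ :=
  scalar b4 (comp g (chartAt E3 p)) (chartAt E3 p p, 0)

/-- Glues the chartwise scalar curvatures into one function on `V`, to which connectedness can be
applied. -/
theorem scalarAt_eq (hg : IsLorentzMetric g) (he : e ∈ atlas E3 V) {p : V} (hp : p ∈ e.source) :
    scalar b4 (comp g e) (e p, 0) = scalarAt g p := by
  have hmem : e p ∈ (e.symm ≫ₕ chartAt E3 p).source := by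
    rw [OpenPartialHomeomorph.trans_source]
    refine ⟨e.map_source hp, ?_⟩
    rw [mem_preimage, e.left_inv hp]
    exact mem_chart_source E3 p
  rw [scalar_transition hg (chart_mem_atlas E3 p) he (z := (e p, 0)) ⟨hmem, mem_univ _⟩,
    transition, e.left_inv hp, scalarAt]

/-- A field with vanishing trace of Yang's equations has constant scalar curvature. -/
theorem scalarAt_const [ConnectedSpace V] (hg : IsLorentzMetric g)
    (h : ∀ e ∈ atlas E3 V, ∀ y ∈ e.target,
      fderiv ℝ (fun z => scalar b4 (comp g e) (z, 0)) y = 0) (p q : V) :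
    scalarAt g p = scalarAt g q := by
  have hloc : IsLocallyConstant (scalarAt g) := by
    rw [IsLocallyConstant.iff_eventually_eq]
    intro p
    set e := chartAt E3 p
    have he : e ∈ atlas E3 V := chart_mem_atlas E3 p
    have hp : p ∈ e.source := mem_chart_source E3 p
    -- A chart target need not be connected, so a vanishing derivative is integrated on a ball
    -- inside it.
    obtain ⟨r, hr, hball⟩ := Metric.isOpen_iff.mp e.open_target (e p) (e.map_source hp)
    have hdiff : DifferentiableOn ℝ (fun z : E3 => scalar b4 (comp g e) (z, 0))
        (Metric.ball (e p) r) :=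
      (((isMetricOn_comp hg he).contDiffOn_scalar.comp
        (contDiff_prodMk_left (0 : ℝ)).contDiffOn fun w hw => ⟨hball hw, mem_univ _⟩ :
          ContDiffOn ℝ 1 (fun z : E3 => scalar b4 (comp g e) (z, 0)) _)).differentiableOn
        one_ne_zero
    filter_upwards [(e.continuousAt hp).preimage_mem_nhds (Metric.ball_mem_nhds _ hr),
      e.open_source.mem_nhds hp] with q hq hqs
    rw [← scalarAt_eq hg he hqs, ← scalarAt_eq hg he hp]
    exact Metric.isOpen_ball.is_const_of_fderiv_eq_zero (convex_ball _ _).isPreconnected hdiff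
      (fun w hw => h e he w (hball hw)) hq (Metric.mem_ball_self hr)
  exact hloc.apply_eq_of_preconnectedSpace p q

/-- The left-hand side of (3) is minus the scalar curvature of spacetime, and the trace of Yang's
equations is half its gradient along `V₀`. Connectedness is needed only to pass from zero gradient
to one global constant. -/
theorem yangTrace_iff_constraint3 [ConnectedSpace V] (hg : IsLorentzMetric g)
    (hn : IsUnitNormal g n) :
    (∀ e ∈ atlas E3 V, ∀ y ∈ e.target, YangTrace g e y) ↔ Constraint3 g n := by
  constructor
  · intro hY
    obtain ⟨p₀⟩ : Nonempty V := inferInstance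
    refine ⟨-scalarAt g p₀, fun e he y hy => ?_⟩
    have hC := isSliceChart hg hn he
    rw [hC.scalar_constraint hy, ← e.right_inv hy, scalarAt_eq hg he (e.map_target hy),
      scalarAt_const hg (fun e he y hy => ((isSliceChart hg hn he).yangTrace_iff hy).mp (hY e he y hy))]
  · rintro ⟨C, hC⟩ e he y hy
    have hS := isSliceChart hg hn he
    rw [hS.yangTrace_iff hy]
    have h1 : (fun z : E3 => scalar b4 (comp g e) (z, 0)) =ᶠ[nhds y] fun _ => -C := by
      filter_upwards [e.open_target.mem_nhds hy] with w hw
      rw [← hC e he w hw, hS.scalar_constraint hw, neg_neg]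
    rw [h1.fderiv_eq]
    simp

end Slice

end

/-! ### The constraint theorem. -/

theorem mainTheorem11 {V : Type*} [TopologicalSpace V] [ChartedSpace Slice.E3 V]
    [IsManifold (𝓡 3) ∞ V] [ConnectedSpace V]
    (g : Slice.BilinField V) (hg : Slice.IsLorentzMetric g) (hs : Slice.IsSliced g)
    (n : Slice.VecField V) (hn : Slice.IsUnitNormal g n) :
    (Slice.YangEq g →
      (∀ e ∈ atlas Slice.E3 V, ∀ y ∈ e.target, Slice.Constraint1 g n e y) ∧
      (∀ e ∈ atlas Slice.E3 V, ∀ y ∈ e.target, Slice.Constraint2 g n e y) ∧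
      Slice.Constraint3 g n) ∧
    (∀ e ∈ atlas Slice.E3 V, ∀ y ∈ e.target,
      (Slice.YangTangential g e y ↔ Slice.Constraint1 g n e y) ∧
      (Slice.YangNormal g n e y ↔ Slice.Constraint2 g n e y)) ∧
    ((∀ e ∈ atlas Slice.E3 V, ∀ y ∈ e.target, Slice.YangTrace g e y) ↔
      Slice.Constraint3 g n) := by
  have hC := fun e (he : e ∈ atlas Slice.E3 V) => Slice.isSliceChart hg hn he
  refine ⟨fun hY => ⟨fun e he y hy => ((hC e he).yangTangential_iff hy).mp ?_,
    fun e he y hy => ((hC e he).yangNormal_iff hy).mp ?_,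
    (Slice.yangTrace_iff_constraint3 hg hn).mp fun e he y hy i => ?_⟩,
    fun e he y hy => ⟨(hC e he).yangTangential_iff hy, (hC e he).yangNormal_iff hy⟩,
    Slice.yangTrace_iff_constraint3 hg hn⟩
  · exact fun i j k => hY e he y hy 0 _ _ _
  · intro i j
    simp [hY e he y hy 0]
  · simp [hY e he y hy 0]
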